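/- Let $E=(E^0,E^1,r,s)$ be an arbitrary directed graph (no restriction on the cardinalities of $E^0$, $E^1$). A vertex $v$ is \emph{singular} if $s^{-1}(v)$ is empty or infinite. A finite path is a vertex $v$ (with source and range $v$) or a sequence of edges $e_1\cdots e_n$, $n\ge 1$, with $r(e_i)=s(e_{i+1})$ (with source $s(e_1)$ and range $r(e_n)$). An infinite path is a sequence $e_1e_2\cdots$ of edges with $r(e_i)=s(e_{i+1})$ for all $i$ (with source $s(e_1)$). The set $\partial E$ of \emph{boundary paths} is the disjoint union of the set of infinite paths and the set of finite paths whose range is a singular vertex. The shift $\sigma:\partial E\to\partial E$ removes the first edge of a path of positive length and fixes vertices; $\alpha,\beta\in\partial E$ are \emph{shift-tail equivalent}, $\alpha\sim_{st}\beta$, if $\sigma^m(\alpha)=\sigma^n(\beta)$ for some $m,n\in\mathbb N$. Let $[\alpha]$ denote the class of $\alpha$ and $\widetilde\partial E$ the set of classes. Let $L_k(E)$ be the Leavitt path algebra of $E$ over a field $k$, i.e. the universal (not necessarily unital) $k$-algebra generated by pairwise orthogonal idempotents $p_v$ ($v\in E^0$) and elements $s_e,s_e^*$ ($e\in E^1$)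 such that $p_{s(e)}s_e=s_e=s_ep_{r(e)}$, $p_{r(e)}s_e^*=s_e^*=s_e^*p_{s(e)}$, $s_e^*s_e=p_{r(e)}$, $s_e^*s_f=0$ for $e\neq f$, and $p_v=\sum_{s(e)=v}s_es_e^*$ whenever $0<|s^{-1}(v)|<\infty$. Let $C^*(E)$ be the graph $C^*$-algebra, i.e. the universal $C^*$-algebra generated by mutually orthogonal projections $p_v$ and partial isometries $s_e$ with mutually orthogonal ranges such that $s_e^*s_e=p_{r(e)}$, $s_es_e^*\le p_{s(e)}$, and $p_v=\sum_{s(e)=v}s_es_e^*$ whenever $0<|s^{-1}(v)|<\infty$. A representation is \emph{irreducible} if its space is nonzero and has no invariant subspace (closed invariant subspace, for $*$-representations) other than $\{0\}$ and the whole space. Representations are \emph{algebraically} (resp. \emph{unitarily}) \emph{equivalent} if they are intertwined by a linear isomorphism (resp. a unitary). \textbf{Theorem.} (a) Let $k$ be a field and let $V=\operatorname{span}_k\partial E$ be the $k$-vector space with basis $\partial E$. There is a unique algebra homomorphism $\rho:L_k(E)\to\operatorname{End}_k(V)$ such that for all $e\in E^1$, $v\in E^0$, $\alpha\in\partial E$: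 $$\rho(s_e)\alpha=\begin{cases}e\alpha&\text{if }s(\alpha)=r(e)\\0&\text{otherwise,}\end{cases}\quad \rho(s_e^*)\alpha=\begin{cases}\alpha'&\text{if }\alpha=e\alpha'\text{ with }\alpha'\in\partial E\\0&\text{otherwise,}\end{cases}\quad \rho(p_v)\alpha=\begin{cases}\alpha&\text{if }s(\alpha)=v\\0&\text{otherwise.}\end{cases}$$ For every $\alpha\in\partial E$ the subspace $V_{[\alpha]}=\operatorname{span}_k[\alpha]$ is $\rho$-invariant and the restriction $\rho_{[\alpha]}=\rho|_{V_{[\alpha]}}$ is irreducible. Moreover $V=\bigoplus_{[\alpha]\in\widetilde\partial E}V_{[\alpha]}$ and $\rho=\bigoplus_{[\alpha]\in\widetilde\partial E}\rho_{[\alpha]}$. For $\alpha,\beta\in\partial E$ the following are equivalent: (i) $\rho_{[\alpha]}$ is algebraically equivalent to $\rho_{[\beta]}$; (ii) $\rho_{[\alpha]}=\rho_{[\beta]}$ (equal subspaces and equal representations); (iii) $\alpha\sim_{st}\beta$; (iv) $[\alpha]=[\beta]$. (b) Let $H=\ell^2(\partial E)$ be the complex Hilbert space with orthonormal basis $\partial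 E$. There is a unique $*$-homomorphism $\pi:C^*(E)\to\mathbb B(H)$ for which $\pi(s_e)$, $\pi(s_e^*)$, $\pi(p_v)$ act on the basis $\partial E$ by the formulas displayed in (a). For every $\alpha\in\partial E$ the closed subspace $H_{[\alpha]}=\ell^2([\alpha])$ is $\pi$-invariant and the restriction $\pi_{[\alpha]}=\pi|_{H_{[\alpha]}}$ is irreducible. Moreover $H=\bigoplus_{[\alpha]\in\widetilde\partial E}H_{[\alpha]}$ and $\pi=\bigoplus_{[\alpha]\in\widetilde\partial E}\pi_{[\alpha]}$ as Hilbert space direct sums. For $\alpha,\beta\in\partial E$ the following are equivalent: (i) $\pi_{[\alpha]}$ is unitarily equivalent to $\pi_{[\beta]}$; (ii) $\pi_{[\alpha]}=\pi_{[\beta]}$ (equal subspaces and equal representations); (iii) $\alpha\sim_{st}\beta$; (iv) $[\alpha]=[\beta]$. -/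

import Mathlib

open scoped ENNReal DirectSum Classical

universe u v w x

noncomputable section

/-- A directed graph with vertex set `V` and edge set `Ed`, without any restriction. -/
structure DirGraph (V : Type u) (Ed : Type v) where
  range : Ed → V
  source : Ed → V

namespace DirGraph

variable {V : Type u} {Ed : Type v} (E : DirGraph V Ed)

/-- The set of edges emitted by the vertex `a`. -/
def emitted (a : V) : Set Ed := {e | E.source e = a}

/-- A vertex is singular when it is a sink or an infinite emitter. -/
def IsSingular (a : V) : Prop := E.emitted a = ∅ ∨ (E.emitted a).Infinite

/-! ### Paths -/

/-- `E.IsPathFrom a l`: the list of edges `l` is a path with source `a`. -/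
def IsPathFrom : V → List Ed → Prop
  | _, [] => True
  | a, e :: l => E.source e = a ∧ IsPathFrom (E.range e) l

/-- The range of the path with source `a` and list of edges `l`. -/
def endpoint : V → List Ed → V
  | a, [] => a
  | _, e :: l => endpoint (E.range e) l

/-- A finite path is a vertex (empty list of edges) or a nonempty composable sequence of edges. -/
@[ext] structure FinitePath where
  source : V
  edges : List Ed
  isPath : E.IsPathFrom source edges

/-- The range of a finite path. -/
def FinitePath.range {E : DirGraph V Ed} (α : E.FinitePath) : V := E.endpoint α.source α.edges

/-- A singular path is a finite path whose range is a singular vertex. -/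
def SingularPath : Type (max u v) := {α : E.FinitePath // E.IsSingular α.range}

/-- An infinite path is a sequence of edges, each one starting where the previous one ends. -/
def InfinitePath : Type v := {ω : ℕ → Ed // ∀ n, E.range (ω n) = E.source (ω (n + 1))}

/-- The boundary of the graph: infinite paths and singular paths. -/
def Boundary : Type (max u v) := E.InfinitePath ⊕ E.SingularPath

namespace Boundary

variable {E}

/-- The source of a boundary path. -/
def source : E.Boundary → V
  | .inl ω => E.source (ω.1 0)
  | .inr α => α.1.source

/-- The boundary path `eα`, for an edge `e` and a boundary path `α` with source `r(e)`. -/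
def cons (e : Ed) : (α : E.Boundary) → α.source = E.range e → E.Boundary
  | .inl ω, h => .inl ⟨fun n => Nat.casesOn n e ω.1, fun n => by
      cases n with
      | zero => exact h.symm
      | succ n => exact ω.2 n⟩
  | .inr ⟨⟨a, l, hl⟩, hα⟩, h =>
      have h' : a = E.range e := h
      .inr ⟨⟨E.source e, e :: l, rfl, h' ▸ hl⟩, by
        subst h'
        exact hα⟩

/-- The shift map removes the first edge and fixes vertices. -/
def shift : E.Boundary → E.Boundary
  | .inl ω => .inl ⟨fun n => ω.1 (n + 1), fun n => ω.2 (n + 1)⟩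
  | .inr ⟨⟨a, [], hl⟩, hα⟩ => .inr ⟨⟨a, [], hl⟩, hα⟩
  | .inr ⟨⟨_, e :: l, hl⟩, hα⟩ => .inr ⟨⟨E.range e, l, hl.2⟩, hα⟩

/-- Shift-tail equivalence of boundary paths. -/
def ShiftTailEquiv (α β : E.Boundary) : Prop :=
  ∃ m n : ℕ, shift^[m] α = shift^[n] β

end Boundary

/-- The set of shift-tail equivalence classes, as subsets of the boundary. -/
def ShiftTailClass : Type (max u v) :=
  {c : Set E.Boundary // ∃ α : E.Boundary, c = {β | β.ShiftTailEquiv α}}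

variable {E} in
/-- The shift-tail equivalence class `[α]`. -/
def Boundary.cls (α : E.Boundary) : E.ShiftTailClass := ⟨{β | β.ShiftTailEquiv α}, α, rfl⟩

/-! ### The Leavitt path algebra -/

/-- The symbols `p_v`, `s_e` and `s_e^*`. -/
inductive LeavittSymbol (V : Type u) (Ed : Type v) : Type (max u v)
  | vertex (a : V)
  | edge (e : Ed)
  | ghost (e : Ed)

section Leavitt

variable (k : Type w) [Field k]

/-- The symbol `p_v` in the free algebra. -/
abbrev freeP (a : V) : FreeAlgebra k (LeavittSymbol V Ed) := FreeAlgebra.ι k (.vertex a)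

/-- The symbol `s_e` in the free algebra. -/
abbrev freeS (e : Ed) : FreeAlgebra k (LeavittSymbol V Ed) := FreeAlgebra.ι k (.edge e)

/-- The symbol `s_e^*` in the free algebra. -/
abbrev freeT (e : Ed) : FreeAlgebra k (LeavittSymbol V Ed) := FreeAlgebra.ι k (.ghost e)

/-- The defining relations of the Leavitt path algebra. -/
inductive LeavittRel : FreeAlgebra k (LeavittSymbol V Ed) → FreeAlgebra k (LeavittSymbol V Ed) → Prop
  | idem (a : V) : LeavittRel (freeP k a * freeP k a) (freeP k a)
  | orth (a b : V) (h : a ≠ b) : LeavittRel (freeP k a * freeP k b) 0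
  | source_edge (e : Ed) : LeavittRel (freeP k (E.source e) * freeS k e) (freeS k e)
  | edge_range (e : Ed) : LeavittRel (freeS k e * freeP k (E.range e)) (freeS k e)
  | range_ghost (e : Ed) : LeavittRel (freeP k (E.range e) * freeT k e) (freeT k e)
  | ghost_source (e : Ed) : LeavittRel (freeT k e * freeP k (E.source e)) (freeT k e)
  | ghost_edge (e : Ed) : LeavittRel (freeT k e * freeS k e) (freeP k (E.range e))
  | ghost_edge_ne (e f : Ed) (h : e ≠ f) : LeavittRel (freeT k e * freeS k f) 0
  | vertex_sum (a : V) (hfin : (E.emitted a).Finite) (hne : (E.emitted a).Nonempty) :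
      LeavittRel (freeP k a) (∑ e ∈ hfin.toFinset, freeS k e * freeT k e)

/-- The image of a symbol in the free unital algebra modulo the defining relations. -/
def leavittGen (g : LeavittSymbol V Ed) : RingQuot (E.LeavittRel k) :=
  RingQuot.mkAlgHom k (E.LeavittRel k) (FreeAlgebra.ι k g)

/-- The Leavitt path algebra `L_k(E)`, the universal (not necessarily unital) `k`-algebra on the
symbols `p_v`, `s_e`, `s_e^*` subject to the defining relations. The relations have no constant
terms, so the free *unital* algebra modulo the relations is the unitization of the universal
non-unital algebra, and the latter is the non-unital subalgebra generated by the symbols. -/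
def LeavittPathAlgebra : Type (max u v w) :=
  NonUnitalAlgebra.adjoin k (Set.range (E.leavittGen k))

instance : NonUnitalRing (E.LeavittPathAlgebra k) :=
  inferInstanceAs (NonUnitalRing (NonUnitalAlgebra.adjoin k (Set.range (E.leavittGen k))))

instance : Module k (E.LeavittPathAlgebra k) :=
  inferInstanceAs (Module k (NonUnitalAlgebra.adjoin k (Set.range (E.leavittGen k))))

instance : IsScalarTower k (E.LeavittPathAlgebra k) (E.LeavittPathAlgebra k) :=
  inferInstanceAs (IsScalarTower k (NonUnitalAlgebra.adjoin k (Set.range (E.leavittGen k)))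
    (NonUnitalAlgebra.adjoin k (Set.range (E.leavittGen k))))

instance : SMulCommClass k (E.LeavittPathAlgebra k) (E.LeavittPathAlgebra k) :=
  inferInstanceAs (SMulCommClass k (NonUnitalAlgebra.adjoin k (Set.range (E.leavittGen k)))
    (NonUnitalAlgebra.adjoin k (Set.range (E.leavittGen k))))

namespace LeavittPathAlgebra

/-- The generators of the Leavitt path algebra. -/
def gen (g : LeavittSymbol V Ed) : E.LeavittPathAlgebra k :=
  ⟨E.leavittGen k g, NonUnitalAlgebra.subset_adjoin k ⟨g, rfl⟩⟩

/-- The generator `p_v`. -/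
def p (a : V) : E.LeavittPathAlgebra k := gen E k (.vertex a)

/-- The generator `s_e`. -/
def s (e : Ed) : E.LeavittPathAlgebra k := gen E k (.edge e)

/-- The generator `s_e^*`. -/
def sStar (e : Ed) : E.LeavittPathAlgebra k := gen E k (.ghost e)

end LeavittPathAlgebra

end Leavitt

/-! ### The graph C*-algebra -/

/-- A Cuntz-Krieger `E`-family in a C*-algebra `B`: mutually orthogonal projections `p_v` and
partial isometries `s_e` with mutually orthogonal ranges, satisfying the defining relations of the
graph C*-algebra. For projections `q` and `p`, the relation `q ≤ p` is expressed as `p * q = q`. -/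
structure CuntzKriegerFamily (B : Type w) [NonUnitalCStarAlgebra B] where
  p : V → B
  s : Ed → B
  proj (a : V) : IsStarProjection (p a)
  orth (a b : V) (h : a ≠ b) : p a * p b = 0
  partialIsometry (e : Ed) : s e * star (s e) * s e = s e
  range_orth (e f : Ed) (h : e ≠ f) : (s e * star (s e)) * (s f * star (s f)) = 0
  star_mul_self (e : Ed) : star (s e) * s e = p (E.range e)
  mul_star_le (e : Ed) : p (E.source e) * (s e * star (s e)) = s e * star (s e)
  vertex_sum (a : V) (hfin : (E.emitted a).Finite) (hne : (E.emitted a).Nonempty) :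
    p a = ∑ e ∈ hfin.toFinset, s e * star (s e)

variable {E} in
theorem CuntzKriegerFamily.norm_p_le {B : Type w} [NonUnitalCStarAlgebra B]
    (t : E.CuntzKriegerFamily B) (a : V) : ‖t.p a‖ ≤ 1 := (t.proj a).norm_le

variable {E} in
theorem CuntzKriegerFamily.norm_s_le {B : Type w} [NonUnitalCStarAlgebra B]
    (t : E.CuntzKriegerFamily B) (e : Ed) : ‖t.s e‖ ≤ 1 := by
  have h := CStarRing.norm_star_mul_self (x := t.s e)
  rw [t.star_mul_self] at h
  have := t.norm_p_le (E.range e)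
  nlinarith [norm_nonneg (t.s e)]

/-- All Cuntz-Krieger `E`-families in all C*-algebras of the universe of `E`. -/
structure CKIndex : Type (max u v + 1) where
  B : Type (max u v)
  [inst : NonUnitalCStarAlgebra B]
  family : E.CuntzKriegerFamily B

instance (i : E.CKIndex) : NonUnitalCStarAlgebra i.B := i.inst

/-- The C*-algebra of bounded families indexed by all Cuntz-Krieger `E`-families. -/
abbrev CKProduct : Type (max u v + 1) := lp (fun i : E.CKIndex => i.B) ∞

/-- The universal `p_v`: its coordinate at a Cuntz-Krieger family is the `p_v` of that family. -/
def univP (a : V) : E.CKProduct :=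
  ⟨fun i => i.family.p a, memℓp_infty ⟨1, by rintro _ ⟨i, rfl⟩; exact i.family.norm_p_le a⟩⟩

/-- The universal `s_e`: its coordinate at a Cuntz-Krieger family is the `s_e` of that family. -/
def univS (e : Ed) : E.CKProduct :=
  ⟨fun i => i.family.s e, memℓp_infty ⟨1, by rintro _ ⟨i, rfl⟩; exact i.family.norm_s_le e⟩⟩

/-- The graph C*-algebra `C*(E)` as a closed `*`-subalgebra of `CKProduct`: the norm of a
`*`-polynomial in the generators is the supremum of its norms over all Cuntz-Krieger families. -/
def cstarSubalgebra : NonUnitalStarSubalgebra ℂ E.CKProduct :=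
  (NonUnitalStarAlgebra.adjoin ℂ (Set.range E.univP ∪ Set.range E.univS)).topologicalClosure

/-- The graph C*-algebra `C*(E)`, the universal C*-algebra generated by a Cuntz-Krieger family.
(A C*-algebra generated by such a family is small, so that families in C*-algebras of the universe
of `E` determine the norm.) -/
def GraphCStarAlgebra : Type (max u v + 1) := E.cstarSubalgebra

instance : IsClosed (E.cstarSubalgebra : Set E.CKProduct) :=
  NonUnitalStarSubalgebra.isClosed_topologicalClosure _

instance : NonUnitalCStarAlgebra E.GraphCStarAlgebra :=
  inferInstanceAs (NonUnitalCStarAlgebra E.cstarSubalgebra)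

namespace GraphCStarAlgebra

/-- The generator `p_v`. -/
def p (a : V) : E.GraphCStarAlgebra :=
  ⟨E.univP a, NonUnitalStarSubalgebra.le_topologicalClosure _
    (NonUnitalStarAlgebra.subset_adjoin ℂ _ (Or.inl ⟨a, rfl⟩))⟩

/-- The generator `s_e`. -/
def s (e : Ed) : E.GraphCStarAlgebra :=
  ⟨E.univS e, NonUnitalStarSubalgebra.le_topologicalClosure _
    (NonUnitalStarAlgebra.subset_adjoin ℂ _ (Or.inr ⟨e, rfl⟩))⟩

end GraphCStarAlgebra

end DirGraph

/-! ### Representations of algebras -/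

section AlgebraRepresentations

variable {k : Type w} [Field k] {A : Type x} [NonUnitalRing A] [Module k A]
variable {M : Type u} [AddCommMonoid M] [Module k M] {N : Type v} [AddCommMonoid N] [Module k N]

/-- The subspace `W` is `ρ`-invariant. -/
def AlgInvariant (ρ : A →ₙₐ[k] Module.End k M) (W : Submodule k M) : Prop :=
  ∀ a, ∀ y ∈ W, ρ a y ∈ W

/-- The subrepresentation of `ρ` on an invariant subspace. -/
def algRestrict (ρ : A →ₙₐ[k] Module.End k M) (W : Submodule k M) (h : AlgInvariant ρ W) :
    A →ₙₐ[k] Module.End k W where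
  toFun a := (ρ a).restrict (h a)
  map_smul' c a := by ext y; simp
  map_zero' := by ext y; simp
  map_add' a b := by ext y; simp
  map_mul' a b := by ext y; simp

/-- A representation is irreducible when its space is nonzero and has no invariant subspaces
other than zero and the whole space. -/
def AlgIrreducible (ρ : A →ₙₐ[k] Module.End k M) : Prop :=
  Nontrivial M ∧ ∀ W : Submodule k M, AlgInvariant ρ W → W = ⊥ ∨ W = ⊤

/-- Algebraic equivalence of representations. -/
def AlgEquivalent (ρ₁ : A →ₙₐ[k] Module.End k M) (ρ₂ : A →ₙₐ[k] Module.End k N) : Prop :=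
  ∃ T : M ≃ₗ[k] N, ∀ a, ρ₁ a = T.symm.toLinearMap ∘ₗ ρ₂ a ∘ₗ T.toLinearMap

/-- `M` is the internal direct sum of the subspaces `W i`, and `ρ` is the direct sum of the
representations `σ i` on them. -/
def IsAlgDirectSum {ι : Type*} (ρ : A →ₙₐ[k] Module.End k M) (W : ι → Submodule k M)
    (σ : ∀ i, A →ₙₐ[k] Module.End k (W i)) : Prop :=
  DirectSum.IsInternal W ∧ ∀ a, ∀ y : ⨁ i, W i,
    ρ a (DirectSum.coeLinearMap W y) =
      DirectSum.coeLinearMap W (DirectSum.lmap (fun i => σ i a) y)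

/-- A subspace of `M` together with a representation on it; two of these are equal when the
subspaces are equal and the representations are equal. -/
structure AlgRepOn (k : Type w) [Field k] (A : Type x) [NonUnitalRing A] [Module k A]
    (M : Type u) [AddCommMonoid M] [Module k M] where
  space : Submodule k M
  rep : A →ₙₐ[k] Module.End k space

end AlgebraRepresentations

/-! ### `*`-representations of C*-algebras -/

section StarRepresentations

variable {A : Type x} [NonUnitalCStarAlgebra A]
variable {H : Type u} [NormedAddCommGroup H] [InnerProductSpace ℂ H] [CompleteSpace H]
variable {K : Type v} [NormedAddCommGroup K] [InnerProductSpace ℂ K] [CompleteSpace K]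

/-- The subspace `W` is `π`-invariant. -/
def StarInvariant (π : A →⋆ₙₐ[ℂ] (H →L[ℂ] H)) (W : Submodule ℂ H) : Prop :=
  ∀ a, ∀ y ∈ W, π a y ∈ W

/-- The subrepresentation of `π` on a closed invariant subspace. -/
def starRestrict (π : A →⋆ₙₐ[ℂ] (H →L[ℂ] H)) (W : Submodule ℂ H) [CompleteSpace W]
    (h : StarInvariant π W) : A →⋆ₙₐ[ℂ] (W →L[ℂ] W) where
  toFun a := (π a).restrict (h a)
  map_smul' c a := by ext y; simp
  map_zero' := by ext y; simp
  map_add' a b := by ext y; simp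
  map_mul' a b := by ext y; simp
  map_star' a := by
    rw [ContinuousLinearMap.star_eq_adjoint, ContinuousLinearMap.eq_adjoint_iff]
    intro y z
    have : π (star a) = ContinuousLinearMap.adjoint (π a) := by
      rw [map_star, ContinuousLinearMap.star_eq_adjoint]
    simp [Submodule.coe_inner, this, ContinuousLinearMap.adjoint_inner_left]

/-- A `*`-representation is irreducible when its space is nonzero and has no closed invariant
subspaces other than zero and the whole space. -/
def StarIrreducible (π : A →⋆ₙₐ[ℂ] (H →L[ℂ] H)) : Prop :=
  Nontrivial H ∧ ∀ W : Submodule ℂ H, IsClosed (W : Set H) → StarInvariant π W → W = ⊥ ∨ W = ⊤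

/-- Unitary equivalence of `*`-representations. -/
def UnitarilyEquivalent (π₁ : A →⋆ₙₐ[ℂ] (H →L[ℂ] H)) (π₂ : A →⋆ₙₐ[ℂ] (K →L[ℂ] K)) : Prop :=
  ∃ U : H ≃ₗᵢ[ℂ] K, ∀ a y, π₁ a y = U.symm (π₂ a (U y))

/-- `H` is the Hilbert space direct sum of the subspaces `W i`, and under the canonical unitary
from `H` to the `ℓ²`-sum of the `W i` the operators `π a` act coordinatewise by the `σ i a`. -/
def IsStarDirectSum {ι : Type*} (π : A →⋆ₙₐ[ℂ] (H →L[ℂ] H)) (W : ι → Submodule ℂ H)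
    [∀ i, CompleteSpace (W i)] (σ : ∀ i, A →⋆ₙₐ[ℂ] (W i →L[ℂ] W i)) : Prop :=
  ∃ h : IsHilbertSum ℂ (fun i => W i) (fun i => (W i).subtypeₗᵢ),
    ∀ a y i, h.linearIsometryEquiv (π a y) i = σ i a (h.linearIsometryEquiv y i)

/-- A closed subspace of `H` together with a `*`-representation on it; two of these are equal when
the subspaces are equal and the `*`-representations are equal. -/
structure StarRepOn (A : Type x) [NonUnitalCStarAlgebra A] (H : Type u) [NormedAddCommGroup H]
    [InnerProductSpace ℂ H] [CompleteSpace H] where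
  space : Submodule ℂ H
  [complete : CompleteSpace space]
  rep : A →⋆ₙₐ[ℂ] (space →L[ℂ] space)

end StarRepresentations

/-! ### Spaces and representations associated with boundary paths -/

namespace DirGraph

variable {V : Type u} {Ed : Type v} (E : DirGraph V Ed)

/-- The `k`-vector space with basis the boundary paths. -/
abbrev BoundarySpace (k : Type w) [Field k] := E.Boundary →₀ k

/-- The basis vector of a boundary path. -/
abbrev basisVec (k : Type w) [Field k] (α : E.Boundary) : E.BoundarySpace k := Finsupp.single α 1

/-- The linear span of a set of boundary paths. -/
def spanOf (k : Type w) [Field k] (C : Set E.Boundary) : Submodule k (E.BoundarySpace k) :=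
  Submodule.span k (E.basisVec k '' C)

/-- The Hilbert space `ℓ²(∂E)`. -/
abbrev BoundaryHilbert := lp (fun _ : E.Boundary => ℂ) 2

/-- The orthonormal basis vector of a boundary path. -/
abbrev basisVecL2 (α : E.Boundary) : E.BoundaryHilbert := lp.single 2 α (1 : ℂ)

/-- `ℓ²(C)` as a closed subspace of `ℓ²(∂E)`: the closed linear span of a set of boundary paths. -/
def l2Of (C : Set E.Boundary) : Submodule ℂ E.BoundaryHilbert :=
  (Submodule.span ℂ (E.basisVecL2 '' C)).topologicalClosure

instance (C : Set E.Boundary) : CompleteSpace (E.l2Of C) :=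
  inferInstanceAs (CompleteSpace (Submodule.span ℂ (E.basisVecL2 '' C)).topologicalClosure)

/-- The formulas that describe the boundary path representation of `L_k(E)`. -/
structure IsBoundaryRep (k : Type w) [Field k]
    (ρ : E.LeavittPathAlgebra k →ₙₐ[k] Module.End k (E.BoundarySpace k)) : Prop where
  s_apply (e : Ed) (α : E.Boundary) : ρ (LeavittPathAlgebra.s E k e) (E.basisVec k α) =
    if h : α.source = E.range e then E.basisVec k (α.cons e h) else 0
  sStar_apply_cons (e : Ed) (α' : E.Boundary) (h : α'.source = E.range e) :
    ρ (LeavittPathAlgebra.sStar E k e) (E.basisVec k (α'.cons e h)) = E.basisVec k α'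
  sStar_apply_of_ne (e : Ed) (α : E.Boundary)
    (hα : ∀ (α' : E.Boundary) (h : α'.source = E.range e), α ≠ α'.cons e h) :
    ρ (LeavittPathAlgebra.sStar E k e) (E.basisVec k α) = 0
  p_apply (a : V) (α : E.Boundary) : ρ (LeavittPathAlgebra.p E k a) (E.basisVec k α) =
    if α.source = a then E.basisVec k α else 0

/-- The formulas that describe the boundary path `*`-representation of `C*(E)`. -/
structure IsBoundaryStarRep
    (π : E.GraphCStarAlgebra →⋆ₙₐ[ℂ] (E.BoundaryHilbert →L[ℂ] E.BoundaryHilbert)) : Prop where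
  s_apply (e : Ed) (α : E.Boundary) : π (GraphCStarAlgebra.s E e) (E.basisVecL2 α) =
    if h : α.source = E.range e then E.basisVecL2 (α.cons e h) else 0
  sStar_apply_cons (e : Ed) (α' : E.Boundary) (h : α'.source = E.range e) :
    π (star (GraphCStarAlgebra.s E e)) (E.basisVecL2 (α'.cons e h)) = E.basisVecL2 α'
  sStar_apply_of_ne (e : Ed) (α : E.Boundary)
    (hα : ∀ (α' : E.Boundary) (h : α'.source = E.range e), α ≠ α'.cons e h) :
    π (star (GraphCStarAlgebra.s E e)) (E.basisVecL2 α) = 0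
  p_apply (a : V) (α : E.Boundary) : π (GraphCStarAlgebra.p E a) (E.basisVecL2 α) =
    if α.source = a then E.basisVecL2 α else 0

end DirGraph

end

/-!
The vertices, edges and ghost edges act on boundary paths by partial injections, so the defining
relations of both algebras can be checked on single boundary paths (`BoundaryFamily`); the only
relation that uses that a path lies in the boundary is the one at a regular vertex, where every
boundary path must have a first edge. The Leavitt path algebra is a quotient of a free algebra,
which gives its representation on `BoundarySpace`. The same operators on `BoundaryHilbert` form a
Cuntz-Krieger family, and the graph C*-algebra, being made of bounded families indexed by all
Cuntz-Krieger families, is represented by taking the coordinate at this one. Uniqueness holds as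
both algebras are generated by the symbols, for the C*-algebra together with the continuity of
`*`-homomorphisms.

The structure of the representations rests on two observations.

* The algebra separates boundary paths by diagonal operators: for `α ≠ β` it contains the projection
  onto a set of boundary paths that contains `α` and not `β`
  (`BoundaryFamily.exists_diagonalSet_separating`). The sets whose projections lie in the algebra
  are closed under intersection, difference and adding a first edge; so two paths that are not
  separated have the same source and the same first edge, and their shifts are not separated
  either, which forces them to be equal (`Boundary.eq_of_bisim`).
* An invariant subspace that contains one boundary path contains its shift-tail class
  (`BoundaryFamily.mem_of_shiftTailEquiv`), since edges and ghost edges add and remove first edges.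

For irreducibility in the algebraic case, a diagonal operator that isolates one path in the finite
support of a nonzero vector shows that this path lies in the invariant subspace. In the Hilbert
space case, the orthogonal projection onto a closed invariant subspace commutes with the diagonal
operators, hence every path lies in the subspace or is orthogonal to it. Finally, an intertwiner
between the representations of two different classes commutes with the diagonal operators as well,
so all coordinates of the image of a path vanish, and the intertwiner is not injective.
-/

noncomputable section

namespace DirGraph

/-! ### Boundary paths and shift-tail equivalence -/

namespace Boundary

variable {V : Type u} {Ed : Type v} {E : DirGraph V Ed}

@[simp] theorem source_cons (e : Ed) (α : E.Boundary) (h : α.source = E.range e) :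
    (α.cons e h).source = E.source e := by
  rcases α with ω | ⟨⟨a, l, hl⟩, hα⟩ <;> rfl

@[simp] theorem shift_cons (e : Ed) (α : E.Boundary) (h : α.source = E.range e) :
    (α.cons e h).shift = α := by
  rcases α with ω | ⟨⟨a, l, hl⟩, hα⟩
  · rfl
  · obtain rfl : a = E.range e := h
    rfl

/-- A boundary path either has a first edge or is a singular vertex. -/
theorem eq_cons_shift_or (γ : E.Boundary) :
    (∃ e h, γ = γ.shift.cons e h) ∨
      ∃ a hl hα, γ = .inr ⟨⟨a, [], hl⟩, hα⟩ := by
  rcases γ with ω | ⟨⟨a, _ | ⟨e, l⟩, hl⟩, hα⟩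
  · refine .inl ⟨ω.1 0, (ω.2 0).symm, ?_⟩
    refine congrArg Sum.inl (Subtype.ext (funext fun n => ?_))
    cases n <;> rfl
  · exact .inr ⟨a, hl, hα, rfl⟩
  · obtain ⟨rfl, hl'⟩ := hl
    exact .inl ⟨e, rfl, rfl⟩

theorem cons_ne_vertex (e : Ed) (α : E.Boundary) (h : α.source = E.range e) (a hl hα) :
    α.cons e h ≠ .inr ⟨⟨a, [], hl⟩, hα⟩ := by
  rcases α with ω | ⟨⟨a, l, hl⟩, hα⟩
  · exact Sum.inl_ne_inr
  · intro H
    have := congrArg (fun α => α.1.edges) (Sum.inr_injective H)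
    simp at this

theorem cons_inj {e f : Ed} {α β : E.Boundary} {h : α.source = E.range e}
    {h' : β.source = E.range f} : α.cons e h = β.cons f h' ↔ e = f ∧ α = β := by
  constructor
  · intro H
    have hαβ : α = β := by simpa using congrArg shift H
    subst hαβ
    refine ⟨?_, rfl⟩
    rcases α with ω | ⟨⟨a, l, hl⟩, hα⟩
    · exact congrFun (congrArg Subtype.val (Sum.inl_injective H)) 0
    · have := congrArg (fun α => α.1.edges) (Sum.inr_injective H)
      simpa [DirGraph.Boundary.cons] using this
  · rintro ⟨rfl, rfl⟩
    rfl

/-- Bisimilar boundary paths are equal: a symmetric relation that respects sources, and for paths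
that are not both vertices forces a common first edge and passes to the shifts, is contained in
equality. -/
theorem eq_of_bisim (R : E.Boundary → E.Boundary → Prop)
    (hsource : ∀ α β, R α β → α.source = β.source)
    (hcons : ∀ e α h β, R (cons e α h) β → ∃ β' h', β = cons e β' h' ∧ R α β')
    (hsymm : ∀ α β, R α β → R β α) (α β : E.Boundary) (H : R α β) : α = β := by
  have finite (l : List Ed) : ∀ a hl hα β, R (.inr ⟨⟨a, l, hl⟩, hα⟩) β →
      (.inr ⟨⟨a, l, hl⟩, hα⟩ : E.Boundary) = β := by
    induction l with
    | nil =>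
      intro a hl hα β H
      obtain ⟨e, h, hβ⟩ | ⟨b, hb, hβ, rfl⟩ := eq_cons_shift_or β
      · rw [hβ] at H
        obtain ⟨β', h', H', -⟩ := hcons _ _ _ _ (hsymm _ _ H)
        exact (cons_ne_vertex _ _ _ _ _ _ H'.symm).elim
      · obtain rfl : a = b := hsource _ _ H
        rfl
    | cons e l ih =>
      rintro a ⟨rfl, hl⟩ hα β H
      obtain ⟨β', h', rfl, H'⟩ := hcons e (.inr ⟨⟨_, l, hl⟩, hα⟩) rfl β H
      obtain rfl := ih _ _ _ _ H'
      rfl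
  rcases α with ω | ⟨⟨a, l, hl⟩, hα⟩
  · rcases β with η | ⟨⟨a, l, hl⟩, hα⟩
    · have infinite (n : ℕ) : ∀ ω η : E.InfinitePath, R (.inl ω) (.inl η) → ω.1 n = η.1 n := by
        have step (ω η : E.InfinitePath) (H : R (.inl ω) (.inl η)) : ω.1 0 = η.1 0 ∧
            R (.inl ⟨fun n => ω.1 (n + 1), fun n => ω.2 (n + 1)⟩)
              (.inl ⟨fun n => η.1 (n + 1), fun n => η.2 (n + 1)⟩) := by
          obtain ⟨e, h, hω⟩ | ⟨_, _, _, hω⟩ := eq_cons_shift_or (.inl ω : E.Boundary)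
          · rw [hω] at H
            obtain ⟨β', h', hη, H'⟩ := hcons _ _ _ _ H
            obtain rfl : shift (.inl η) = β' := by simpa using congrArg shift hη
            have h1 := congrFun (congrArg Subtype.val (Sum.inl_injective hω)) 0
            have h2 := congrFun (congrArg Subtype.val (Sum.inl_injective hη)) 0
            exact ⟨h1.trans h2.symm, H'⟩
          · exact absurd hω Sum.inl_ne_inr
        induction n with
        | zero => exact fun ω η H => (step ω η H).1
        | succ n ih => exact fun ω η H => ih _ _ (step ω η H).2
      exact congrArg Sum.inl (Subtype.ext (funext fun n => infinite n ω η H))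
    · exact (finite _ _ _ _ _ (hsymm _ _ H)).symm
  · exact finite _ _ _ _ _ H

/-- A boundary path with a regular source has a first edge. -/
theorem exists_eq_cons_of_not_isSingular (γ : E.Boundary) (h : ¬ E.IsSingular γ.source) :
    ∃ e h, γ = γ.shift.cons e h := by
  obtain h' | ⟨a, hl, hα, rfl⟩ := eq_cons_shift_or γ
  · exact h'
  · exact absurd hα h

namespace ShiftTailEquiv

theorem refl (α : E.Boundary) : α.ShiftTailEquiv α := ⟨0, 0, rfl⟩

theorem symm {α β : E.Boundary} : α.ShiftTailEquiv β → β.ShiftTailEquiv α :=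
  fun ⟨m, n, h⟩ => ⟨n, m, h.symm⟩

theorem trans {α β γ : E.Boundary} :
    α.ShiftTailEquiv β → β.ShiftTailEquiv γ → α.ShiftTailEquiv γ := by
  rintro ⟨m, n, h⟩ ⟨p, q, h'⟩
  refine ⟨p + m, n + q, ?_⟩
  rw [Function.iterate_add_apply, h, ← Function.iterate_add_apply, add_comm p n,
    Function.iterate_add_apply, h', ← Function.iterate_add_apply]

theorem cons (e : Ed) (α : E.Boundary) (h : α.source = E.range e) :
    (α.cons e h).ShiftTailEquiv α := ⟨1, 0, by simp⟩

/-- A set of boundary paths that is stable under adding and removing a first edge is saturated for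
shift-tail equivalence. -/
theorem mem_of_stable {S : Set E.Boundary}
    (hS : ∀ (e : Ed) (α : E.Boundary) (h : α.source = E.range e), α.cons e h ∈ S ↔ α ∈ S)
    {α β : E.Boundary} (h : β.ShiftTailEquiv α) (hα : α ∈ S) : β ∈ S := by
  have step (γ : E.Boundary) : γ.shift ∈ S ↔ γ ∈ S := by
    obtain ⟨e, h, hγ⟩ | ⟨a, hl, hα, rfl⟩ := eq_cons_shift_or γ
    · rw [← hS e _ h, ← hγ]
    · rfl
  have steps (n : ℕ) (γ : E.Boundary) : Boundary.shift^[n] γ ∈ S ↔ γ ∈ S := by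
    induction n generalizing γ with
    | zero => rfl
    | succ n ih => rw [Function.iterate_succ_apply, ih, step]
  obtain ⟨m, n, h⟩ := h
  rwa [← steps m, h, steps n]

end ShiftTailEquiv

theorem cls_eq_iff {α β : E.Boundary} : α.cls = β.cls ↔ α.ShiftTailEquiv β := by
  constructor
  · intro h
    have : α ∈ α.cls.1 := .refl α
    rwa [h] at this
  · intro h
    exact Subtype.ext (Set.ext fun γ => ⟨fun hγ => hγ.trans h, fun hγ => hγ.trans h.symm⟩)

end Boundary

namespace ShiftTailClass

variable {V : Type u} {Ed : Type v} {E : DirGraph V Ed}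

theorem mem_iff (c : E.ShiftTailClass) (α : E.Boundary) : α ∈ c.1 ↔ α.cls = c := by
  obtain ⟨_, β, rfl⟩ := c
  exact Boundary.cls_eq_iff.symm

theorem cons_mem_iff (c : E.ShiftTailClass) (e : Ed) (α : E.Boundary)
    (h : α.source = E.range e) : α.cons e h ∈ c.1 ↔ α ∈ c.1 := by
  rw [mem_iff, mem_iff, Boundary.cls_eq_iff.2 (.cons e α h)]

theorem nonempty (c : E.ShiftTailClass) : c.1.Nonempty := by
  obtain ⟨_, β, rfl⟩ := c
  exact ⟨β, .refl β⟩

theorem pairwise_disjoint {c d : E.ShiftTailClass} (h : c ≠ d) : Disjoint c.1 d.1 :=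
  Set.disjoint_left.2 fun α hc hd => h (((mem_iff c α).1 hc).symm.trans ((mem_iff d α).1 hd))

theorem iUnion_eq_univ : ⋃ c : E.ShiftTailClass, c.1 = Set.univ :=
  Set.eq_univ_of_forall fun α => Set.mem_iUnion.2 ⟨α.cls, .refl α⟩

end ShiftTailClass

end DirGraph

namespace DirGraph

/-! ### Families of operators that act on boundary paths -/

/-- Operators `P a`, `S e`, `T e` on a space with a family of vectors `b` indexed by the boundary
paths act on these vectors by the formulas of the boundary path representation, `T e` in the role
of `s_e^*`. The vectors need not be a basis: they are one for `BoundarySpace`, and they span a dense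
subspace for `BoundaryHilbert`. -/
structure BoundaryFamily {V : Type u} {Ed : Type v} (E : DirGraph V Ed) {k : Type w} [Field k]
    {M : Type x} [AddCommGroup M] [Module k M] (b : E.Boundary → M)
    (P : V → Module.End k M) (S T : Ed → Module.End k M) : Prop where
  edge (e : Ed) (α : E.Boundary) :
    S e (b α) = if h : α.source = E.range e then b (α.cons e h) else 0
  ghost_cons (e : Ed) (α : E.Boundary) (h : α.source = E.range e) : T e (b (α.cons e h)) = b α
  ghost_of_ne (e : Ed) (α : E.Boundary)
    (hα : ∀ (α' : E.Boundary) (h : α'.source = E.range e), α ≠ α'.cons e h) : T e (b α) = 0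
  vertex (a : V) (α : E.Boundary) : P a (b α) = if α.source = a then b α else 0

namespace BoundaryFamily

variable {V : Type u} {Ed : Type v} {E : DirGraph V Ed} {k : Type w} [Field k]
  {M : Type x} [AddCommGroup M] [Module k M] {b : E.Boundary → M}
  {P : V → Module.End k M} {S T : Ed → Module.End k M}

theorem ghost_cons_of_ne (F : E.BoundaryFamily b P S T) {e f : Ed} (hef : e ≠ f) (α : E.Boundary)
    (h : α.source = E.range f) : T e (b (α.cons f h)) = 0 :=
  F.ghost_of_ne e _ fun _ _ H => hef (Boundary.cons_inj.1 H).1.symm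

theorem ghost_of_source_ne (F : E.BoundaryFamily b P S T) {e : Ed} {α : E.Boundary}
    (h : α.source ≠ E.source e) : T e (b α) = 0 :=
  F.ghost_of_ne e _ fun _ _ H => h (H ▸ Boundary.source_cons ..)

/-- Two families on the same vectors agree on these vectors. -/
theorem apply_eq (F : E.BoundaryFamily b P S T) {P' : V → Module.End k M}
    {S' T' : Ed → Module.End k M} (F' : E.BoundaryFamily b P' S' T') (α : E.Boundary) :
    (∀ a, P a (b α) = P' a (b α)) ∧ ∀ e, S e (b α) = S' e (b α) ∧ T e (b α) = T' e (b α) := by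
  refine ⟨fun a => by rw [F.vertex, F'.vertex], fun e => ⟨by rw [F.edge, F'.edge], ?_⟩⟩
  by_cases H : ∃ (α' : E.Boundary) (h : α'.source = E.range e), α = α'.cons e h
  · obtain ⟨α', h, rfl⟩ := H
    rw [F.ghost_cons, F'.ghost_cons]
  · push Not at H
    rw [F.ghost_of_ne e α H, F'.ghost_of_ne e α H]

section Relations

variable (F : E.BoundaryFamily b P S T) (γ : E.Boundary)
include F

theorem idem (a : V) : P a (P a (b γ)) = P a (b γ) := by
  by_cases h : γ.source = a <;> simp [F.vertex, h]

theorem orth {a c : V} (h : a ≠ c) : P a (P c (b γ)) = 0 := by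
  by_cases h' : γ.source = c
  · simp [F.vertex, h', h.symm]
  · simp [F.vertex, h']

theorem source_edge (e : Ed) : P (E.source e) (S e (b γ)) = S e (b γ) := by
  by_cases h : γ.source = E.range e <;> simp [F.edge, F.vertex, h]

theorem edge_range (e : Ed) : S e (P (E.range e) (b γ)) = S e (b γ) := by
  by_cases h : γ.source = E.range e <;> simp [F.edge, F.vertex, h]

theorem range_ghost (e : Ed) : P (E.range e) (T e (b γ)) = T e (b γ) := by
  by_cases H : ∃ (α' : E.Boundary) (h : α'.source = E.range e), γ = α'.cons e h
  · obtain ⟨α', h, rfl⟩ := H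
    simp [F.ghost_cons, F.vertex, h]
  · push Not at H
    simp [F.ghost_of_ne e γ H]

theorem ghost_source (e : Ed) : T e (P (E.source e) (b γ)) = T e (b γ) := by
  by_cases h : γ.source = E.source e
  · simp [F.vertex, h]
  · simp [F.vertex, h, F.ghost_of_source_ne h]

theorem ghost_edge (e : Ed) : T e (S e (b γ)) = P (E.range e) (b γ) := by
  by_cases h : γ.source = E.range e <;> simp [F.edge, F.vertex, F.ghost_cons, h]

theorem ghost_edge_ne {e f : Ed} (hef : e ≠ f) : T e (S f (b γ)) = 0 := by
  by_cases h : γ.source = E.range f <;> simp [F.edge, F.ghost_cons_of_ne hef, h]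

theorem vertex_sum (a : V) (hfin : (E.emitted a).Finite) (hne : (E.emitted a).Nonempty) :
    P a (b γ) = ∑ e ∈ hfin.toFinset, S e (T e (b γ)) := by
  by_cases h : γ.source = a
  · -- A path that starts at a regular vertex has a first edge, which contributes the only nonzero
    -- summand.
    obtain ⟨e, h', hγ⟩ := γ.exists_eq_cons_of_not_isSingular (by
      rw [h]
      exact not_or.2 ⟨hne.ne_empty, fun hinf => hinf hfin⟩)
    have he : E.source e = a := by
      rw [hγ] at h
      simpa using h
    rw [Finset.sum_eq_single_of_mem e (by simpa [emitted] using he)]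
    · rw [F.vertex, if_pos h, hγ, F.ghost_cons, F.edge, dif_pos h']
    · intro f _ hf
      rw [hγ, F.ghost_cons_of_ne hf, map_zero]
  · rw [F.vertex, if_neg h]
    refine (Finset.sum_eq_zero fun e he => ?_).symm
    have he : E.source e = a := by simpa [emitted] using he
    rw [F.ghost_of_source_ne (he ▸ h), map_zero]

end Relations

/-- `DiagonalSet b R D`: the algebra `R` of operators contains one that fixes the vectors of the
boundary paths in `D` and annihilates those of the others. -/
def DiagonalSet (b : E.Boundary → M) (R : NonUnitalSubalgebra k (Module.End k M))
    (D : Set E.Boundary) : Prop :=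
  ∃ r ∈ R, ∀ γ, r (b γ) = if γ ∈ D then b γ else 0

section Separation

variable (F : E.BoundaryFamily b P S T) {R : NonUnitalSubalgebra k (Module.End k M)}

theorem DiagonalSet.inter {C D : Set E.Boundary} :
    DiagonalSet b R C → DiagonalSet b R D → DiagonalSet b R (C ∩ D) := by
  rintro ⟨r, hr, hr'⟩ ⟨t, ht, ht'⟩
  refine ⟨r * t, mul_mem hr ht, fun γ => ?_⟩
  by_cases hC : γ ∈ C <;> by_cases hD : γ ∈ D <;> simp [hr', ht', hC, hD]

theorem DiagonalSet.diff {C D : Set E.Boundary} :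
    DiagonalSet b R C → DiagonalSet b R D → DiagonalSet b R (C \ D) := by
  rintro ⟨r, hr, hr'⟩ ⟨t, ht, ht'⟩
  refine ⟨r - r * t, sub_mem hr (mul_mem hr ht), fun γ => ?_⟩
  by_cases hC : γ ∈ C <;> by_cases hD : γ ∈ D <;> simp [hr', ht', hC, hD]

include F

theorem diagonalSet_source (hP : ∀ a, P a ∈ R) (a : V) :
    DiagonalSet b R {γ | γ.source = a} :=
  ⟨P a, hP a, fun γ => by simp [F.vertex]⟩

/-- Conjugation by an edge prepends that edge to the paths of a diagonal set. -/
theorem diagonalSet_cons (hS : ∀ e, S e ∈ R) (hT : ∀ e, T e ∈ R) {D : Set E.Boundary}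
    (hD : DiagonalSet b R D) (e : Ed) :
    DiagonalSet b R {γ | ∃ α h, γ = α.cons e h ∧ α ∈ D} := by
  obtain ⟨r, hr, hr'⟩ := hD
  refine ⟨S e * (r * T e), mul_mem (hS e) (mul_mem hr (hT e)), fun γ => ?_⟩
  by_cases H : ∃ (α' : E.Boundary) (h : α'.source = E.range e), γ = α'.cons e h
  · obtain ⟨α, h, rfl⟩ := H
    by_cases hα : α ∈ D <;>
      simp [F.ghost_cons, hr', hα, F.edge, h, Boundary.cons_inj]
  · have H' : γ ∉ {γ | ∃ α h, γ = Boundary.cons e α h ∧ α ∈ D} :=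
      fun ⟨α, h, h', _⟩ => H ⟨α, h, h'⟩
    push Not at H
    rw [if_neg H']
    simp [F.ghost_of_ne e γ H]

/-- Distinct boundary paths are separated by diagonal sets: not being separated is a
bisimulation. -/
theorem exists_diagonalSet_separating (hP : ∀ a, P a ∈ R) (hS : ∀ e, S e ∈ R) (hT : ∀ e, T e ∈ R)
    {α β : E.Boundary} (hαβ : α ≠ β) : ∃ D, DiagonalSet b R D ∧ α ∈ D ∧ β ∉ D := by
  contrapose! hαβ
  refine Boundary.eq_of_bisim (fun α β => ∀ D, DiagonalSet b R D → α ∈ D → β ∈ D)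
    (fun α β H => (H _ (F.diagonalSet_source hP α.source) rfl).symm) ?_ ?_ α β hαβ
  · intro e α h β H
    obtain ⟨β', h', rfl, -⟩ := H _
      (F.diagonalSet_cons hS hT (F.diagonalSet_source hP (E.range e)) e) ⟨α, h, rfl, h⟩
    refine ⟨β', h', rfl, fun D hD hα => ?_⟩
    obtain ⟨β'', h'', hβ, hβ'⟩ := H _ (F.diagonalSet_cons hS hT hD e) ⟨α, h, rfl, hα⟩
    rwa [(Boundary.cons_inj.1 hβ).2]
  · -- Separation is symmetric because the complement of a diagonal set within the paths with a
    -- given source is again a diagonal set.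
    intro α β H D hD hβ
    by_contra hα
    exact (H _ ((F.diagonalSet_source hP α.source).diff hD) ⟨rfl, hα⟩).2 hβ

theorem exists_diagonalSet_separating_finset (hP : ∀ a, P a ∈ R) (hS : ∀ e, S e ∈ R)
    (hT : ∀ e, T e ∈ R) (α : E.Boundary) (s : Finset E.Boundary) (hs : α ∉ s) :
    ∃ D, DiagonalSet b R D ∧ α ∈ D ∧ ∀ β ∈ s, β ∉ D := by
  induction s using Finset.induction_on with
  | empty => exact ⟨_, F.diagonalSet_source hP α.source, rfl, by simp⟩
  | insert β s _ ih =>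
    rw [Finset.mem_insert, not_or] at hs
    obtain ⟨D, hD, hα, hsD⟩ := ih hs.2
    obtain ⟨C, hC, hα', hβ⟩ := F.exists_diagonalSet_separating hP hS hT hs.1
    refine ⟨C ∩ D, hC.inter hD, ⟨hα', hα⟩, fun γ hγ h => ?_⟩
    obtain rfl | hγ := Finset.mem_insert.1 hγ
    exacts [hβ h.1, hsD _ hγ h.2]

end Separation

section Saturation

variable (F : E.BoundaryFamily b P S T) {W : Submodule k M}
include F

/-- An invariant subspace contains, with one boundary path, its whole shift-tail class. -/
theorem mem_of_shiftTailEquiv (hS : ∀ e, ∀ y ∈ W, S e y ∈ W) (hT : ∀ e, ∀ y ∈ W, T e y ∈ W)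
    {α β : E.Boundary} (h : β.ShiftTailEquiv α) (hα : b α ∈ W) : b β ∈ W := by
  refine Boundary.ShiftTailEquiv.mem_of_stable (S := {γ | b γ ∈ W}) (fun e γ h => ⟨?_, ?_⟩) h hα
  · intro hγ
    simpa [F.ghost_cons] using hT e _ hγ
  · intro hγ
    simpa [F.edge, h] using hS e _ hγ

/-- The operators of the family map the paths of a shift-tail class into their span. -/
theorem mapsTo_span (c : E.ShiftTailClass) {y : M} (hy : y ∈ Submodule.span k (b '' c.1)) :
    (∀ a, P a y ∈ Submodule.span k (b '' c.1)) ∧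
      ∀ e, S e y ∈ Submodule.span k (b '' c.1) ∧ T e y ∈ Submodule.span k (b '' c.1) := by
  have key (r : Module.End k M) (hr : ∀ α ∈ c.1, r (b α) ∈ Submodule.span k (b '' c.1)) :
      r y ∈ Submodule.span k (b '' c.1) := by
    have : Submodule.span k (b '' c.1) ≤ (Submodule.span k (b '' c.1)).comap r :=
      Submodule.span_le.2 (by rintro _ ⟨α, hα, rfl⟩; exact hr α hα)
    exact this hy
  have mem {α : E.Boundary} (hα : α ∈ c.1) : b α ∈ Submodule.span k (b '' c.1) :=
    Submodule.subset_span ⟨α, hα, rfl⟩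
  refine ⟨fun a => key _ fun α hα => ?_, fun e => ⟨key _ fun α hα => ?_, key _ fun α hα => ?_⟩⟩
  · rw [F.vertex]
    split_ifs
    exacts [mem hα, zero_mem _]
  · rw [F.edge]
    split_ifs with h
    exacts [mem ((c.cons_mem_iff e α h).2 hα), zero_mem _]
  · by_cases H : ∃ (α' : E.Boundary) (h : α'.source = E.range e), α = α'.cons e h
    · obtain ⟨α', h, rfl⟩ := H
      rw [F.ghost_cons]
      exact mem ((c.cons_mem_iff e α' h).1 hα)
    · push Not at H
      rw [F.ghost_of_ne e α H]
      exact zero_mem _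

end Saturation

end BoundaryFamily

end DirGraph

namespace DirGraph

/-! ### The boundary path representation of the Leavitt path algebra -/

variable {V : Type u} {Ed : Type v} (E : DirGraph V Ed) (k : Type w) [Field k]

variable {E k} in
/-- The Leavitt path algebra is generated by its generators. -/
theorem LeavittPathAlgebra.mem_of_gen_mem (B : NonUnitalSubalgebra k (E.LeavittPathAlgebra k))
    (hp : ∀ a, LeavittPathAlgebra.p E k a ∈ B) (hs : ∀ e, LeavittPathAlgebra.s E k e ∈ B)
    (ht : ∀ e, LeavittPathAlgebra.sStar E k e ∈ B) (x : E.LeavittPathAlgebra k) : x ∈ B := by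
  obtain ⟨x, hx⟩ := x
  induction hx using NonUnitalAlgebra.adjoin_induction with
  | mem x hx =>
    obtain ⟨a | e | e, rfl⟩ := hx
    exacts [hp a, hs e, ht e]
  | add x y hx hy ihx ihy => exact add_mem ihx ihy
  | zero => exact zero_mem B
  | mul x y hx hy ihx ihy => exact mul_mem ihx ihy
  | smul c x hx ihx => exact B.toSubmodule.smul_mem c ihx

/-- The operator on `BoundarySpace` that represents a symbol. By `Boundary.cons_inj` the path chosen
in the case of a ghost edge is the only one. -/
def boundaryOp (g : LeavittSymbol V Ed) : Module.End k (E.BoundarySpace k) :=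
  Finsupp.linearCombination k fun α => match g with
    | .vertex a => if α.source = a then E.basisVec k α else 0
    | .edge e => if h : α.source = E.range e then E.basisVec k (α.cons e h) else 0
    | .ghost e =>
      if H : ∃ (α' : E.Boundary) (h : α'.source = E.range e), α = α'.cons e h then
        E.basisVec k H.choose else 0

theorem boundaryFamily_boundaryOp : E.BoundaryFamily (E.basisVec k)
    (fun a => E.boundaryOp k (.vertex a)) (fun e => E.boundaryOp k (.edge e))
    (fun e => E.boundaryOp k (.ghost e)) where
  edge e α := by simp [boundaryOp]
  ghost_cons e α h := by
    have H : ∃ (α' : E.Boundary) (h' : α'.source = E.range e), α.cons e h = α'.cons e h' :=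
      ⟨α, h, rfl⟩
    have hα : H.choose = α := by
      obtain ⟨h', H'⟩ := H.choose_spec
      exact (Boundary.cons_inj.1 H').2.symm
    simp only [boundaryOp, Finsupp.linearCombination_single, one_smul, dif_pos H, hα]
  ghost_of_ne e α hα := by
    have H : ¬ ∃ (α' : E.Boundary) (h : α'.source = E.range e), α = α'.cons e h :=
      fun ⟨α', h, H⟩ => hα α' h H
    simp only [boundaryOp, Finsupp.linearCombination_single, one_smul, dif_neg H]
  vertex a α := by simp [boundaryOp]

variable {E k} in
theorem boundarySpace_hom_ext {f g : Module.End k (E.BoundarySpace k)}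
    (h : ∀ γ, f (E.basisVec k γ) = g (E.basisVec k γ)) : f = g :=
  Finsupp.lhom_ext' fun γ => LinearMap.ext_ring (h γ)

theorem lift_boundaryOp_rel ⦃x y : FreeAlgebra k (LeavittSymbol V Ed)⦄ (h : E.LeavittRel k x y) :
    FreeAlgebra.lift k (E.boundaryOp k) x = FreeAlgebra.lift k (E.boundaryOp k) y := by
  have F := E.boundaryFamily_boundaryOp k
  induction h <;> refine boundarySpace_hom_ext fun γ => ?_ <;>
    simp only [map_mul, map_zero, map_sum, FreeAlgebra.lift_ι_apply, Module.End.mul_apply,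
      LinearMap.zero_apply, LinearMap.sum_apply]
  case idem a => exact F.idem γ a
  case orth a c h => exact F.orth γ h
  case source_edge e => exact F.source_edge γ e
  case edge_range e => exact F.edge_range γ e
  case range_ghost e => exact F.range_ghost γ e
  case ghost_source e => exact F.ghost_source γ e
  case ghost_edge e => exact F.ghost_edge γ e
  case ghost_edge_ne e f h => exact F.ghost_edge_ne γ h
  case vertex_sum a hfin hne => exact F.vertex_sum γ a hfin hne

/-- The boundary path representation of the Leavitt path algebra. -/
def boundaryRep : E.LeavittPathAlgebra k →ₙₐ[k] Module.End k (E.BoundarySpace k) :=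
  ((RingQuot.liftAlgHom k ⟨FreeAlgebra.lift k (E.boundaryOp k), E.lift_boundaryOp_rel k⟩ :
      RingQuot (E.LeavittRel k) →ₐ[k] Module.End k (E.BoundarySpace k)) :
    RingQuot (E.LeavittRel k) →ₙₐ[k] Module.End k (E.BoundarySpace k)).comp
  (NonUnitalSubalgebraClass.subtype (NonUnitalAlgebra.adjoin k (Set.range (E.leavittGen k))))

theorem boundaryRep_gen (g : LeavittSymbol V Ed) :
    E.boundaryRep k (LeavittPathAlgebra.gen E k g) = E.boundaryOp k g := by
  have h : RingQuot.liftAlgHom k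
      ⟨FreeAlgebra.lift k (E.boundaryOp k), E.lift_boundaryOp_rel k⟩ (E.leavittGen k g) =
      E.boundaryOp k g := by
    rw [leavittGen, RingQuot.liftAlgHom_mkAlgHom_apply, FreeAlgebra.lift_ι_apply]
  exact h

theorem isBoundaryRep_iff (ρ : E.LeavittPathAlgebra k →ₙₐ[k] Module.End k (E.BoundarySpace k)) :
    E.IsBoundaryRep k ρ ↔ E.BoundaryFamily (E.basisVec k)
      (fun a => ρ (LeavittPathAlgebra.p E k a)) (fun e => ρ (LeavittPathAlgebra.s E k e))
      (fun e => ρ (LeavittPathAlgebra.sStar E k e)) :=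
  ⟨fun h => ⟨h.s_apply, h.sStar_apply_cons, h.sStar_apply_of_ne, h.p_apply⟩,
    fun h => ⟨h.edge, h.ghost_cons, h.ghost_of_ne, h.vertex⟩⟩

theorem existsUnique_isBoundaryRep :
    ∃! ρ : E.LeavittPathAlgebra k →ₙₐ[k] Module.End k (E.BoundarySpace k),
      E.IsBoundaryRep k ρ := by
  refine ⟨E.boundaryRep k, ?_, fun ρ hρ => ?_⟩
  · refine (E.isBoundaryRep_iff k _).2 ?_
    simpa only [LeavittPathAlgebra.p, LeavittPathAlgebra.s, LeavittPathAlgebra.sStar,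
      boundaryRep_gen] using E.boundaryFamily_boundaryOp k
  · replace hρ := (E.isBoundaryRep_iff k ρ).1 hρ
    have h (γ : E.Boundary) := hρ.apply_eq (E.boundaryFamily_boundaryOp k) γ
    refine NonUnitalAlgHom.ext fun x => LeavittPathAlgebra.mem_of_gen_mem
      (NonUnitalAlgHom.equalizer ρ (E.boundaryRep k)) (fun a => ?_) (fun e => ?_) (fun e => ?_) x
    · exact (boundarySpace_hom_ext fun γ => (h γ).1 a).trans (E.boundaryRep_gen k _).symm
    · exact (boundarySpace_hom_ext fun γ => ((h γ).2 e).1).trans (E.boundaryRep_gen k _).symm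
    · exact (boundarySpace_hom_ext fun γ => ((h γ).2 e).2).trans (E.boundaryRep_gen k _).symm

/-! ### Invariant subspaces of the representation of the Leavitt path algebra -/

variable {E k}

/-- A diagonal operator restricts the coordinates of a vector to its set of boundary paths. -/
theorem diagonal_apply_finsupp {D : Set E.Boundary} {r : Module.End k (E.BoundarySpace k)}
    (hr : ∀ γ, r (E.basisVec k γ) = if γ ∈ D then E.basisVec k γ else 0) (y : E.BoundarySpace k)
    (γ : E.Boundary) : r y γ = if γ ∈ D then y γ else 0 := by
  induction y using Finsupp.induction_linear with
  | zero => simp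
  | add y z hy hz =>
    rw [map_add, Finsupp.add_apply, hy, hz, Finsupp.add_apply]
    split_ifs <;> simp
  | single β c =>
    have h : r (Finsupp.single β c) = if β ∈ D then Finsupp.single β c else 0 := by
      rw [← mul_one c, ← smul_eq_mul, ← Finsupp.smul_single, map_smul, hr]
      split_ifs <;> simp
    rw [h]
    obtain rfl | hβ := eq_or_ne β γ
    · split_ifs <;> simp
    · split_ifs <;> simp [Finsupp.single_eq_of_ne hβ.symm]

theorem spanOf_eq_supported (C : Set E.Boundary) : E.spanOf k C = Finsupp.supported k k C :=
  (Finsupp.supported_eq_span_single k C).symm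

theorem basisVec_mem_spanOf {C : Set E.Boundary} {α : E.Boundary} (hα : α ∈ C) :
    E.basisVec k α ∈ E.spanOf k C :=
  Submodule.subset_span ⟨α, hα, rfl⟩

theorem isInternal_spanOf :
    DirectSum.IsInternal fun c : E.ShiftTailClass => E.spanOf k c.1 := by
  rw [DirectSum.isInternal_submodule_iff_iSupIndep_and_iSup_eq_top]
  simp only [spanOf_eq_supported]
  refine ⟨fun c => ?_, ?_⟩
  · rw [iSup_subtype', ← Finsupp.supported_iUnion]
    exact Finsupp.disjoint_supported_supported
      (Set.disjoint_iUnion_right.2 fun d => ShiftTailClass.pairwise_disjoint d.2.symm)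
  · rw [← Finsupp.supported_iUnion, ShiftTailClass.iUnion_eq_univ, Finsupp.supported_univ]

section Rep

variable {ρ : E.LeavittPathAlgebra k →ₙₐ[k] Module.End k (E.BoundarySpace k)}

theorem IsBoundaryRep.algInvariant (hρ : E.IsBoundaryRep k ρ) (c : E.ShiftTailClass) :
    AlgInvariant ρ (E.spanOf k c.1) := by
  have F := (E.isBoundaryRep_iff k ρ).1 hρ
  let B : NonUnitalSubalgebra k (E.LeavittPathAlgebra k) :=
    { carrier := {x | ∀ y ∈ E.spanOf k c.1, ρ x y ∈ E.spanOf k c.1}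
      zero_mem' := fun y _ => by simp
      add_mem' := fun hx hx' y hy => by
        rw [map_add]
        exact add_mem (hx y hy) (hx' y hy)
      mul_mem' := fun hx hx' y hy => by
        rw [map_mul]
        exact hx _ (hx' y hy)
      smul_mem' := fun a x hx y hy => by
        rw [map_smul]
        exact Submodule.smul_mem _ a (hx y hy) }
  exact LeavittPathAlgebra.mem_of_gen_mem B (fun a y hy => (F.mapsTo_span c hy).1 a)
    (fun e y hy => ((F.mapsTo_span c hy).2 e).1) (fun e y hy => ((F.mapsTo_span c hy).2 e).2)

/-- A boundary path representation contains diagonal operators that fix a given boundary path and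
annihilate finitely many given others. -/
theorem IsBoundaryRep.exists_diagonal (hρ : E.IsBoundaryRep k ρ) (α : E.Boundary)
    (s : Finset E.Boundary) (hs : α ∉ s) : ∃ x, ∃ D : Set E.Boundary, α ∈ D ∧ (∀ β ∈ s, β ∉ D) ∧
      ∀ y γ, ρ x y γ = if γ ∈ D then y γ else 0 := by
  obtain ⟨D, ⟨_, ⟨x, rfl⟩, hx⟩, hα, hs⟩ :=
    ((E.isBoundaryRep_iff k ρ).1 hρ).exists_diagonalSet_separating_finset
      (R := NonUnitalAlgHom.range ρ) (fun _ => ⟨_, rfl⟩) (fun _ => ⟨_, rfl⟩) (fun _ => ⟨_, rfl⟩)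
      α s hs
  exact ⟨x, D, hα, hs, diagonal_apply_finsupp hx⟩

/-- Irreducibility: a diagonal operator turns a nonzero vector of an invariant subspace into a
multiple of a boundary path, and from that path its whole class is reached. -/
theorem IsBoundaryRep.spanOf_le (hρ : E.IsBoundaryRep k ρ) (c : E.ShiftTailClass)
    {W : Submodule k (E.BoundarySpace k)} (hW : AlgInvariant ρ W) {y : E.BoundarySpace k}
    (hyW : y ∈ W) (hyc : y ∈ E.spanOf k c.1) (hy : y ≠ 0) : E.spanOf k c.1 ≤ W := by
  obtain ⟨α, hα⟩ := Finsupp.ne_iff.1 hy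
  rw [Finsupp.zero_apply] at hα
  obtain ⟨x, D, hαD, hD, hx⟩ := hρ.exists_diagonal α (y.support.erase α) (by simp)
  have hxy : ρ x y = y α • E.basisVec k α := by
    ext γ
    rw [hx]
    obtain rfl | hγ := eq_or_ne γ α
    · simp [hαD]
    · by_cases hγy : y γ = 0
      · simp [hγy, Finsupp.single_eq_of_ne hγ]
      · have : γ ∉ D := hD γ (by simp [hγ, hγy])
        simp [this, Finsupp.single_eq_of_ne hγ]
  have hαW : E.basisVec k α ∈ W := (W.smul_mem_iff hα).1 (hxy ▸ hW x y hyW)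
  have hαc : α ∈ c.1 := by
    rw [spanOf_eq_supported, Finsupp.mem_supported] at hyc
    exact hyc (by simpa using hα)
  refine Submodule.span_le.2 ?_
  rintro _ ⟨β, hβ, rfl⟩
  have hβα : β.ShiftTailEquiv α := Boundary.cls_eq_iff.1
    (((c.mem_iff β).1 hβ).trans ((c.mem_iff α).1 hαc).symm)
  exact ((E.isBoundaryRep_iff k ρ).1 hρ).mem_of_shiftTailEquiv (fun e => hW _) (fun e => hW _)
    hβα hαW

theorem IsBoundaryRep.algIrreducible (hρ : E.IsBoundaryRep k ρ) (c : E.ShiftTailClass)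
    (h : AlgInvariant ρ (E.spanOf k c.1)) : AlgIrreducible (algRestrict ρ (E.spanOf k c.1) h) := by
  refine ⟨?_, fun W hW => ?_⟩
  · obtain ⟨α, hα⟩ := c.nonempty
    refine ⟨⟨⟨_, basisVec_mem_spanOf hα⟩, 0, fun H => ?_⟩⟩
    have : E.basisVec k α = 0 := congrArg Subtype.val H
    simp at this
  · rw [or_iff_not_imp_left]
    intro hne
    obtain ⟨y, hyW, hy⟩ := W.ne_bot_iff.1 hne
    have hWinv : AlgInvariant ρ (W.map (E.spanOf k c.1).subtype) := by
      rintro x _ ⟨z, hz, rfl⟩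
      exact ⟨_, hW x z hz, rfl⟩
    have hle := hρ.spanOf_le c hWinv ⟨y, hyW, rfl⟩ y.2 (by simpa using hy)
    refine (Submodule.eq_top_iff'.2 fun z => ?_)
    obtain ⟨z', hz', h'⟩ := hle z.2
    rwa [← Subtype.ext (show (z' : E.BoundarySpace k) = z from h')]

/-- An intertwiner sends a path to a vector whose coordinate at every other path vanishes, as the
two paths are separated by a diagonal operator. -/
theorem IsBoundaryRep.cls_eq_of_algEquivalent (hρ : E.IsBoundaryRep k ρ) {c d : E.ShiftTailClass}
    {hc : AlgInvariant ρ (E.spanOf k c.1)} {hd : AlgInvariant ρ (E.spanOf k d.1)}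
    (h : AlgEquivalent (algRestrict ρ (E.spanOf k c.1) hc) (algRestrict ρ (E.spanOf k d.1) hd)) :
    c = d := by
  by_contra hcd
  obtain ⟨T, hT⟩ := h
  obtain ⟨α, hα⟩ := c.nonempty
  let y : E.spanOf k c.1 := ⟨E.basisVec k α, basisVec_mem_spanOf hα⟩
  have hy : y ≠ 0 := fun H => by
    have : E.basisVec k α = 0 := congrArg Subtype.val H
    simp at this
  refine hy (T.map_eq_zero_iff.1 (Subtype.ext (Finsupp.ext fun γ => ?_)))
  by_cases hγ : γ ∈ d.1
  · have hαγ : α ≠ γ := fun H =>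
      Set.disjoint_left.1 (ShiftTailClass.pairwise_disjoint hcd) hα (H ▸ hγ)
    obtain ⟨x, D, hαD, hD, hx⟩ := hρ.exists_diagonal α {γ} (by simpa using hαγ)
    have hxy : algRestrict ρ _ hc x y = y := Subtype.ext (Finsupp.ext fun β => by
      refine (hx y β).trans ?_
      obtain rfl | hβ := eq_or_ne β α
      · simp [hαD]
      · simp [y, Finsupp.single_eq_of_ne hβ])
    have hxT : T (algRestrict ρ _ hc x y) = algRestrict ρ _ hd x (T y) := by
      rw [hT]
      simp
    rw [← hxy, hxT]
    exact (hx (T y) γ).trans (if_neg (hD γ (by simp)))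
  · exact (Finsupp.mem_supported' k _).1 ((spanOf_eq_supported d.1).le (T y).2) γ hγ

end Rep

end DirGraph

section AlgebraRepresentations

variable {k : Type w} [Field k] {A : Type x} [NonUnitalRing A] [Module k A]
  {M : Type u} [AddCommMonoid M] [Module k M]

theorem AlgEquivalent.of_eq {r r' : AlgRepOn k A M} (h : r = r') : AlgEquivalent r.rep r'.rep := by
  subst h
  exact ⟨LinearEquiv.refl k _, fun a => rfl⟩

theorem IsAlgDirectSum.of_isInternal {ι : Type v} {ρ : A →ₙₐ[k] Module.End k M}
    {W : ι → Submodule k M} (hW : DirectSum.IsInternal W) (h : ∀ i, AlgInvariant ρ (W i)) :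
    IsAlgDirectSum ρ W fun i => algRestrict ρ (W i) (h i) := by
  refine ⟨hW, fun a y => ?_⟩
  induction y using DirectSum.induction_on with
  | zero => simp
  | of i z =>
    rw [← DirectSum.lof_eq_of k, DirectSum.lmap_lof, DirectSum.coeLinearMap_lof,
      DirectSum.coeLinearMap_lof]
    rfl
  | add y z hy hz => rw [map_add, map_add, map_add, map_add, hy, hz]

end AlgebraRepresentations

namespace DirGraph

variable {V : Type u} {Ed : Type v} {E : DirGraph V Ed} {k : Type w} [Field k]

theorem IsBoundaryRep.tfae {ρ : E.LeavittPathAlgebra k →ₙₐ[k] Module.End k (E.BoundarySpace k)}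
    (hρ : E.IsBoundaryRep k ρ) (hinv : ∀ c : E.ShiftTailClass, AlgInvariant ρ (E.spanOf k c.1))
    (α β : E.Boundary) : List.TFAE [
      AlgEquivalent (algRestrict ρ (E.spanOf k α.cls.1) (hinv α.cls))
        (algRestrict ρ (E.spanOf k β.cls.1) (hinv β.cls)),
      (⟨E.spanOf k α.cls.1, algRestrict ρ _ (hinv α.cls)⟩ :
          AlgRepOn k (E.LeavittPathAlgebra k) (E.BoundarySpace k)) =
        ⟨E.spanOf k β.cls.1, algRestrict ρ _ (hinv β.cls)⟩,
      α.ShiftTailEquiv β,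
      α.cls = β.cls] := by
  tfae_have 1 → 4 := hρ.cls_eq_of_algEquivalent
  tfae_have 4 → 2 := fun h => by rw [h]
  tfae_have 2 → 1 := AlgEquivalent.of_eq
  tfae_have 3 ↔ 4 := Boundary.cls_eq_iff.symm
  tfae_finish

end DirGraph

/-! ### Square-summable sequences -/

section SquareSummable

open scoped InnerProductSpace ComplexConjugate

variable {ι : Type u}

theorem lp_two_apply_eq_inner (y : lp (fun _ : ι => ℂ) 2) (i : ι) :
    y i = ⟪lp.single 2 i (1 : ℂ), y⟫_ℂ := by
  rw [lp.inner_single_left]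
  simp

theorem lp_two_adjoint_single_apply (r : lp (fun _ : ι => ℂ) 2 →L[ℂ] lp (fun _ : ι => ℂ) 2)
    (i j : ι) : ContinuousLinearMap.adjoint r (lp.single 2 i (1 : ℂ)) j =
      conj (r (lp.single 2 j (1 : ℂ)) i) := by
  rw [lp_two_apply_eq_inner, ContinuousLinearMap.adjoint_inner_right, lp_two_apply_eq_inner,
    inner_conj_symm]

theorem lp_two_hasSum (y : lp (fun _ : ι => ℂ) 2) :
    HasSum (fun i => y i • lp.single 2 i (1 : ℂ)) y := by
  convert lp.hasSum_single ENNReal.ofNat_ne_top y using 2 with i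
  rw [← lp.single_smul, smul_eq_mul, mul_one]

theorem lp_two_mem_of_forall_single_mem {W : Submodule ℂ (lp (fun _ : ι => ℂ) 2)}
    (hW : IsClosed (W : Set (lp (fun _ : ι => ℂ) 2))) {y : lp (fun _ : ι => ℂ) 2}
    (h : ∀ i, y i ≠ 0 → lp.single 2 i (1 : ℂ) ∈ W) : y ∈ W := by
  refine hW.mem_of_tendsto (lp_two_hasSum y)
    (Filter.Eventually.of_forall fun s => W.sum_mem fun i _ => ?_)
  by_cases hi : y i = 0
  · simp [hi]
  · exact W.smul_mem _ (h i hi)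

theorem lp_two_hom_ext {f g : lp (fun _ : ι => ℂ) 2 →L[ℂ] lp (fun _ : ι => ℂ) 2}
    (h : ∀ i, f (lp.single 2 i (1 : ℂ)) = g (lp.single 2 i (1 : ℂ))) : f = g :=
  ContinuousLinearMap.ext fun _ => lp_two_mem_of_forall_single_mem
    (W := LinearMap.eqLocus f.toLinearMap g.toLinearMap)
    (isClosed_eq f.continuous g.continuous) fun i _ => h i

/-- Precomposition of square-summable sequences with a partial injection `f` of domain `D`. -/
def partialComp (D : Set ι) (f : ι → ι) (hf : Set.InjOn f D) :
    lp (fun _ : ι => ℂ) 2 →L[ℂ] lp (fun _ : ι => ℂ) 2 :=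
  have bound (y : lp (fun _ : ι => ℂ) 2) (s : Finset ι) :
      ∑ i ∈ s, ‖(if i ∈ D then y (f i) else 0 : ℂ)‖ ^ (2 : ℝ≥0∞).toReal ≤
        ‖y‖ ^ (2 : ℝ≥0∞).toReal := by
    refine le_trans (le_of_eq ?_) (lp.sum_rpow_le_norm_rpow (by simp) y ({i ∈ s | i ∈ D}.image f))
    rw [Finset.sum_image fun i hi j hj h =>
      hf (Finset.mem_filter.1 hi).2 (Finset.mem_filter.1 hj).2 h, Finset.sum_filter]
    refine Finset.sum_congr rfl fun i _ => ?_
    split_ifs <;> simp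
  LinearMap.mkContinuous
    { toFun := fun y => ⟨fun i => if i ∈ D then y (f i) else 0, memℓp_gen' (bound y)⟩
      map_add' := fun y z => lp.ext <| funext fun i => by
        change (if i ∈ D then (y + z) (f i) else 0) =
          (if i ∈ D then y (f i) else 0) + (if i ∈ D then z (f i) else 0)
        split_ifs <;> simp
      map_smul' := fun c y => lp.ext <| funext fun i => by
        change (if i ∈ D then (c • y) (f i) else 0) = c • (if i ∈ D then y (f i) else 0)
        split_ifs <;> simp } 1
    fun y => by
      rw [one_mul]
      exact lp.norm_le_of_forall_sum_le (by simp) (norm_nonneg y) (bound y)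

theorem partialComp_apply (D : Set ι) (f : ι → ι) (hf : Set.InjOn f D)
    (y : lp (fun _ : ι => ℂ) 2) (i : ι) :
    partialComp D f hf y i = if i ∈ D then y (f i) else 0 := rfl

end SquareSummable

namespace DirGraph

/-! ### The boundary path representation of the graph C*-algebra -/

open scoped InnerProductSpace ComplexConjugate

variable {V : Type u} {Ed : Type v} (E : DirGraph V Ed)

/-- The operator on `BoundaryHilbert` that represents `p_a`. -/
def l2P (a : V) : E.BoundaryHilbert →L[ℂ] E.BoundaryHilbert :=
  partialComp {α | α.source = a} id Function.injective_id.injOn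

/-- The operator on `BoundaryHilbert` that represents `s_e^*`: the coordinate of the image at a path
`α` is the coordinate at `eα`. -/
def l2T (e : Ed) : E.BoundaryHilbert →L[ℂ] E.BoundaryHilbert :=
  partialComp {α | α.source = E.range e}
    (fun α => if h : α.source = E.range e then α.cons e h else α) fun α hα β hβ h => by
      simp only [Set.mem_ofPred_eq] at hα hβ
      simp only [dif_pos hα, dif_pos hβ] at h
      exact (Boundary.cons_inj.1 h).2

/-- The operator on `BoundaryHilbert` that represents `s_e`. -/
def l2S (e : Ed) : E.BoundaryHilbert →L[ℂ] E.BoundaryHilbert :=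
  ContinuousLinearMap.adjoint (E.l2T e)

theorem l2P_apply (a : V) (y : E.BoundaryHilbert) (γ : E.Boundary) :
    E.l2P a y γ = if γ.source = a then y γ else 0 := rfl

theorem l2T_apply (e : Ed) (y : E.BoundaryHilbert) (γ : E.Boundary) :
    E.l2T e y γ = if h : γ.source = E.range e then y (γ.cons e h) else 0 := by
  refine (partialComp_apply _ _ _ y γ).trans ?_
  by_cases h : γ.source = E.range e <;> simp [h]

theorem star_l2P (a : V) : star (E.l2P a) = E.l2P a := by
  rw [ContinuousLinearMap.star_eq_adjoint]
  refine lp_two_hom_ext fun α => lp.ext (funext fun γ => ?_)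
  rw [lp_two_adjoint_single_apply, l2P_apply, l2P_apply]
  obtain rfl | h := eq_or_ne α γ
  · split_ifs <;> simp
  · simp [lp.single_apply, Pi.single_eq_of_ne h, Pi.single_eq_of_ne h.symm]

theorem star_l2S (e : Ed) : star (E.l2S e) = E.l2T e := by
  rw [ContinuousLinearMap.star_eq_adjoint, l2S, ContinuousLinearMap.adjoint_adjoint]

/-- Bounded operators on `BoundaryHilbert` that act on the basis vectors by the formulas of the
boundary path representation. -/
abbrev IsL2Family (P : V → E.BoundaryHilbert →L[ℂ] E.BoundaryHilbert)
    (S T : Ed → E.BoundaryHilbert →L[ℂ] E.BoundaryHilbert) : Prop :=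
  E.BoundaryFamily (k := ℂ) E.basisVecL2 (fun a => (P a).toLinearMap)
    (fun e => (S e).toLinearMap) (fun e => (T e).toLinearMap)

theorem isL2Family : E.IsL2Family E.l2P E.l2S E.l2T where
  edge e α := lp.ext <| funext fun γ => by
    refine (lp_two_adjoint_single_apply (E.l2T e) α γ).trans ?_
    rw [l2T_apply]
    by_cases h : α.source = E.range e
    · rw [dif_pos h, dif_pos h, lp.single_apply, lp.single_apply, Pi.single_apply, Pi.single_apply]
      simp only [apply_ite conj, map_one, map_zero, eq_comm]
    · rw [dif_neg h, dif_neg h]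
      simp
  ghost_cons e α h := lp.ext <| funext fun γ => by
    refine (E.l2T_apply e _ γ).trans ?_
    by_cases hγ : γ.source = E.range e
    · simp [hγ, Pi.single_apply, Boundary.cons_inj]
    · have : γ ≠ α := fun H => hγ (H ▸ h)
      simp [hγ, Pi.single_eq_of_ne this]
  ghost_of_ne e α hα := lp.ext <| funext fun γ => by
    refine (E.l2T_apply e _ γ).trans ?_
    by_cases hγ : γ.source = E.range e
    · simp [hγ, Pi.single_eq_of_ne (hα γ hγ).symm]
    · simp [hγ]
  vertex a α := lp.ext <| funext fun γ => by
    refine (E.l2P_apply a _ γ).trans ?_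
    obtain rfl | h := eq_or_ne γ α
    · split_ifs <;> simp
    · split_ifs <;> simp [Pi.single_eq_of_ne h]

/-- The boundary path operators form a Cuntz-Krieger family. -/
def boundaryCKFamily : E.CuntzKriegerFamily (E.BoundaryHilbert →L[ℂ] E.BoundaryHilbert) where
  p := E.l2P
  s := E.l2S
  proj a := ⟨lp_two_hom_ext fun γ => E.isL2Family.idem γ a, E.star_l2P a⟩
  orth a c h := lp_two_hom_ext fun γ => E.isL2Family.orth γ h
  partialIsometry e := by
    rw [star_l2S]
    refine lp_two_hom_ext fun γ => ?_
    exact (congrArg (E.l2S e) (E.isL2Family.ghost_edge γ e)).trans (E.isL2Family.edge_range γ e)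
  range_orth e f h := by
    rw [star_l2S, star_l2S]
    have : E.l2T e * E.l2S f = 0 := lp_two_hom_ext fun γ => E.isL2Family.ghost_edge_ne γ h
    rw [mul_assoc, ← mul_assoc (E.l2T e), this, zero_mul, mul_zero]
  star_mul_self e := by
    rw [star_l2S]
    exact lp_two_hom_ext fun γ => E.isL2Family.ghost_edge γ e
  mul_star_le e := by
    have : E.l2P (E.source e) * E.l2S e = E.l2S e :=
      lp_two_hom_ext fun γ => E.isL2Family.source_edge γ e
    rw [← mul_assoc, this]
  vertex_sum a hfin hne := by
    simp only [star_l2S]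
    refine lp_two_hom_ext fun γ => ?_
    rw [sum_apply]
    exact E.isL2Family.vertex_sum γ a hfin hne

/-- The boundary path representation of the graph C*-algebra: the coordinate at the boundary path
operators of the product that contains the universal Cuntz-Krieger family. -/
def boundaryStarRep : E.GraphCStarAlgebra →⋆ₙₐ[ℂ] (E.BoundaryHilbert →L[ℂ] E.BoundaryHilbert) where
  toFun x := x.1 (⟨_, E.boundaryCKFamily⟩ : E.CKIndex)
  map_smul' _ _ := rfl
  map_zero' := rfl
  map_add' _ _ := rfl
  map_mul' _ _ := rfl
  map_star' _ := rfl

theorem isBoundaryStarRep_iff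
    (π : E.GraphCStarAlgebra →⋆ₙₐ[ℂ] (E.BoundaryHilbert →L[ℂ] E.BoundaryHilbert)) :
    E.IsBoundaryStarRep π ↔ E.IsL2Family (fun a => π (GraphCStarAlgebra.p E a))
      (fun e => π (GraphCStarAlgebra.s E e)) (fun e => π (star (GraphCStarAlgebra.s E e))) :=
  ⟨fun h => ⟨h.s_apply, h.sStar_apply_cons, h.sStar_apply_of_ne, h.p_apply⟩,
    fun h => ⟨h.edge, h.ghost_cons, h.ghost_of_ne, h.vertex⟩⟩

variable {E} in
/-- The graph C*-algebra is generated by its generators as a C*-algebra. -/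
theorem GraphCStarAlgebra.mem_of_gen_mem (B : NonUnitalStarSubalgebra ℂ E.GraphCStarAlgebra)
    (hB : IsClosed (B : Set E.GraphCStarAlgebra)) (hp : ∀ a, GraphCStarAlgebra.p E a ∈ B)
    (hs : ∀ e, GraphCStarAlgebra.s E e ∈ B) (x : E.GraphCStarAlgebra) : x ∈ B := by
  let j : E.GraphCStarAlgebra →⋆ₙₐ[ℂ] E.CKProduct :=
    NonUnitalStarSubalgebraClass.subtype E.cstarSubalgebra
  have hj : IsClosed (B.map j : Set E.CKProduct) :=
    (NonUnitalStarSubalgebra.isClosed_topologicalClosure _ :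
      IsClosed (E.cstarSubalgebra : Set E.CKProduct)).isClosedEmbedding_subtypeVal.isClosedMap _ hB
  have hle : E.cstarSubalgebra ≤ B.map j := by
    refine NonUnitalStarSubalgebra.topologicalClosure_minimal _
      (NonUnitalStarAlgebra.adjoin_le ?_) hj
    rintro _ (⟨a, rfl⟩ | ⟨e, rfl⟩)
    exacts [⟨_, hp a, rfl⟩, ⟨_, hs e, rfl⟩]
  obtain ⟨y, hy, h⟩ := hle x.2
  obtain rfl : y = x := Subtype.ext h
  exact hy

variable {E} in
theorem GraphCStarAlgebra.star_p (a : V) :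
    star (GraphCStarAlgebra.p E a) = GraphCStarAlgebra.p E a :=
  Subtype.ext (lp.ext (funext fun i => (i.family.proj a).isSelfAdjoint))

variable {E} in
theorem GraphCStarAlgebra.continuous_rep
    (π : E.GraphCStarAlgebra →⋆ₙₐ[ℂ] (E.BoundaryHilbert →L[ℂ] E.BoundaryHilbert)) :
    Continuous π :=
  AddMonoidHomClass.continuous_of_bound π 1 fun x => by
    rw [one_mul]
    exact NonUnitalStarAlgHom.norm_apply_le π x

theorem existsUnique_isBoundaryStarRep :
    ∃! π : E.GraphCStarAlgebra →⋆ₙₐ[ℂ] (E.BoundaryHilbert →L[ℂ] E.BoundaryHilbert),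
      E.IsBoundaryStarRep π := by
  have hT (e : Ed) : E.boundaryStarRep (star (GraphCStarAlgebra.s E e)) = E.l2T e :=
    E.star_l2S e
  refine ⟨E.boundaryStarRep, ?_, fun π hπ => ?_⟩
  · refine (E.isBoundaryStarRep_iff _).2 ?_
    simp only [hT]
    exact E.isL2Family
  · have h (γ : E.Boundary) := ((E.isBoundaryStarRep_iff π).1 hπ).apply_eq E.isL2Family γ
    refine NonUnitalStarAlgHom.ext fun x => GraphCStarAlgebra.mem_of_gen_mem
      (NonUnitalStarAlgHom.equalizer π E.boundaryStarRep)
      (isClosed_eq (GraphCStarAlgebra.continuous_rep _) (GraphCStarAlgebra.continuous_rep _))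
      (fun a => ?_) (fun e => ?_) x
    · exact lp_two_hom_ext fun γ => (h γ).1 a
    · exact lp_two_hom_ext fun γ => ((h γ).2 e).1

end DirGraph

/-! ### Invariant subspaces of the representation of the graph C*-algebra -/

section StarRepresentations

variable {A : Type x} [NonUnitalCStarAlgebra A]
  {H : Type u} [NormedAddCommGroup H] [InnerProductSpace ℂ H] [CompleteSpace H]

attribute [local instance] StarRepOn.complete in
theorem UnitarilyEquivalent.of_eq {r r' : StarRepOn A H} (h : r = r') :
    UnitarilyEquivalent r.rep r'.rep := by
  subst h
  exact ⟨LinearIsometryEquiv.refl ℂ _, fun a y => rfl⟩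

theorem IsStarDirectSum.of_isHilbertSum {ι : Type v} {π : A →⋆ₙₐ[ℂ] (H →L[ℂ] H)}
    {W : ι → Submodule ℂ H} [∀ i, CompleteSpace (W i)]
    (hW : IsHilbertSum ℂ (fun i => W i) (fun i => (W i).subtypeₗᵢ))
    (h : ∀ i, StarInvariant π (W i)) :
    IsStarDirectSum π W fun i => starRestrict π (W i) (h i) := by
  refine ⟨hW, fun a y i => ?_⟩
  let L : lp (fun i => W i) 2 →L[ℂ] W i :=
    lp.evalCLM ℂ (fun i => W i) 2 i ∘L
      (hW.linearIsometryEquiv : H →L[ℂ] lp (fun i => W i) 2) ∘L π a ∘L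
        (hW.linearIsometryEquiv.symm : lp (fun i => W i) 2 →L[ℂ] H)
  let R : lp (fun i => W i) 2 →L[ℂ] W i :=
    starRestrict π (W i) (h i) a ∘L lp.evalCLM ℂ (fun i => W i) 2 i
  have hLR : L = R := by
    refine lp.ext_continuousLinearMap ENNReal.ofNat_ne_top fun j => ContinuousLinearMap.ext
      fun w => ?_
    have hw : π a (hW.linearIsometryEquiv.symm (lp.single 2 j w)) =
        hW.linearIsometryEquiv.symm (lp.single 2 j (starRestrict π (W j) (h j) a w)) := by
      rw [hW.linearIsometryEquiv_symm_apply_single, hW.linearIsometryEquiv_symm_apply_single]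
      rfl
    change hW.linearIsometryEquiv (π a (hW.linearIsometryEquiv.symm (lp.single 2 j w))) i =
      starRestrict π (W i) (h i) a ((lp.single 2 j w : lp (fun i => W i) 2) i)
    rw [hw, LinearIsometryEquiv.apply_symm_apply]
    obtain rfl | hij := eq_or_ne i j
    · rw [lp.single_apply_self, lp.single_apply_self]
    · rw [lp.single_apply_ne _ _ _ hij, lp.single_apply_ne _ _ _ hij, map_zero]
  have := DFunLike.congr_fun hLR (hW.linearIsometryEquiv y)
  change hW.linearIsometryEquiv (π a (hW.linearIsometryEquiv.symm (hW.linearIsometryEquiv y))) i =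
    _ at this
  rwa [LinearIsometryEquiv.symm_apply_apply] at this

end StarRepresentations

namespace DirGraph

open scoped InnerProductSpace

variable {V : Type u} {Ed : Type v} {E : DirGraph V Ed}

theorem isClosed_l2Of (C : Set E.Boundary) : IsClosed (E.l2Of C : Set E.BoundaryHilbert) :=
  Submodule.isClosed_topologicalClosure _

theorem basisVecL2_mem_l2Of {C : Set E.Boundary} {α : E.Boundary} (hα : α ∈ C) :
    E.basisVecL2 α ∈ E.l2Of C :=
  Submodule.le_topologicalClosure _ (Submodule.subset_span ⟨α, hα, rfl⟩)

theorem basisVecL2_ne_zero (α : E.Boundary) : E.basisVecL2 α ≠ 0 := fun h => by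
  have : E.basisVecL2 α α = 0 := by
    rw [h]
    rfl
  rw [lp.single_apply_self] at this
  exact one_ne_zero this

theorem l2Of_le {C : Set E.Boundary} {W : Submodule ℂ E.BoundaryHilbert}
    (hW : IsClosed (W : Set E.BoundaryHilbert)) (h : ∀ α ∈ C, E.basisVecL2 α ∈ W) :
    E.l2Of C ≤ W :=
  Submodule.topologicalClosure_minimal _
    (Submodule.span_le.2 (by rintro _ ⟨α, hα, rfl⟩; exact h α hα)) hW

theorem apply_eq_zero_of_mem_l2Of {C : Set E.Boundary} {y : E.BoundaryHilbert} (hy : y ∈ E.l2Of C)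
    {γ : E.Boundary} (hγ : γ ∉ C) : y γ = 0 := by
  refine l2Of_le (W := (lp.evalCLM ℂ (fun _ : E.Boundary => ℂ) 2 γ).ker)
    (ContinuousLinearMap.isClosed_ker _) (fun α hα => ?_) hy
  have h : γ ≠ α := fun h => hγ (h ▸ hα)
  exact lp.single_apply_ne (E := fun _ : E.Boundary => ℂ) 2 α 1 h

theorem isHilbertSum_l2Of : IsHilbertSum ℂ (fun c : E.ShiftTailClass => E.l2Of c.1)
    (fun c => (E.l2Of c.1).subtypeₗᵢ) := by
  refine IsHilbertSum.mkInternal _ (OrthogonalFamily.of_pairwise fun c d hcd => ?_) fun y _ => ?_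
  · refine fun y hy z hz => ?_
    rw [lp.inner_eq_tsum]
    refine (tsum_congr fun γ => ?_).trans tsum_zero
    by_cases hγ : γ ∈ c.1
    · rw [apply_eq_zero_of_mem_l2Of hz
        (Set.disjoint_left.1 (ShiftTailClass.pairwise_disjoint hcd) hγ), inner_zero_left]
    · rw [apply_eq_zero_of_mem_l2Of hy hγ, inner_zero_right]
  · exact lp_two_mem_of_forall_single_mem (Submodule.isClosed_topologicalClosure _) fun α _ =>
      Submodule.le_topologicalClosure _ (Submodule.mem_iSup_of_mem α.cls
        (basisVecL2_mem_l2Of (.refl α)))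

/-- A diagonal operator restricts the coordinates of a vector to its set of boundary paths. -/
theorem diagonal_apply_l2 {D : Set E.Boundary} {r : E.BoundaryHilbert →L[ℂ] E.BoundaryHilbert}
    (hr : ∀ γ, r (E.basisVecL2 γ) = if γ ∈ D then E.basisVecL2 γ else 0) (y : E.BoundaryHilbert)
    (γ : E.Boundary) : r y γ = if γ ∈ D then y γ else 0 := by
  have h : r = partialComp D id Function.injective_id.injOn := lp_two_hom_ext fun β =>
    lp.ext (funext fun δ => by
      rw [hr, partialComp_apply]
      obtain rfl | hδ := eq_or_ne δ β
      · split_ifs <;> simp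
      · split_ifs <;> simp [Pi.single_eq_of_ne hδ])
  rw [h]
  rfl

/-- The algebra homomorphism to linear maps that underlies a representation by bounded operators. -/
def toLinearRep (π : E.GraphCStarAlgebra →⋆ₙₐ[ℂ] (E.BoundaryHilbert →L[ℂ] E.BoundaryHilbert)) :
    E.GraphCStarAlgebra →ₙₐ[ℂ] Module.End ℂ E.BoundaryHilbert where
  toFun x := (π x).toLinearMap
  map_smul' c x := by simp
  map_zero' := by simp
  map_add' x y := by simp
  map_mul' x y := by
    rw [map_mul]
    rfl

section StarRep

variable {π : E.GraphCStarAlgebra →⋆ₙₐ[ℂ] (E.BoundaryHilbert →L[ℂ] E.BoundaryHilbert)}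

theorem IsBoundaryStarRep.starInvariant (hπ : E.IsBoundaryStarRep π) (c : E.ShiftTailClass) :
    StarInvariant π (E.l2Of c.1) := by
  have F := (E.isBoundaryStarRep_iff π).1 hπ
  let B : NonUnitalStarSubalgebra ℂ E.GraphCStarAlgebra :=
    { carrier := {x | ∀ y ∈ E.l2Of c.1, π x y ∈ E.l2Of c.1 ∧ π (star x) y ∈ E.l2Of c.1}
      zero_mem' := fun y _ => by simp
      add_mem' := fun hx hx' y hy => by
        rw [star_add, map_add, map_add]
        exact ⟨add_mem (hx y hy).1 (hx' y hy).1, add_mem (hx y hy).2 (hx' y hy).2⟩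
      mul_mem' := fun hx hx' y hy => by
        rw [star_mul, map_mul, map_mul]
        exact ⟨(hx _ (hx' y hy).1).1, (hx' _ (hx y hy).2).2⟩
      smul_mem' := fun a x hx y hy => by
        rw [star_smul, map_smul, map_smul]
        exact ⟨Submodule.smul_mem _ a (hx y hy).1, Submodule.smul_mem _ _ (hx y hy).2⟩
      star_mem' := fun hx y hy => by
        rw [star_star]
        exact (hx y hy).symm }
  have hB : IsClosed (B : Set E.GraphCStarAlgebra) := by
    have hπc := GraphCStarAlgebra.continuous_rep π
    have : (B : Set E.GraphCStarAlgebra) = ⋂ y ∈ E.l2Of c.1,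
        ((fun x => π x y) ⁻¹' (E.l2Of c.1) ∩ (fun x => π (star x) y) ⁻¹' (E.l2Of c.1)) := by
      ext x
      simp only [Set.mem_iInter]
      rfl
    rw [this]
    exact isClosed_biInter fun y _ =>
      ((isClosed_l2Of c.1).preimage (hπc.clm_apply continuous_const)).inter
        ((isClosed_l2Of c.1).preimage ((hπc.comp continuous_star).clm_apply continuous_const))
  -- A bounded operator that preserves the span of the class preserves its closure.
  have key (r : E.BoundaryHilbert →L[ℂ] E.BoundaryHilbert)
      (hr : ∀ y ∈ Submodule.span ℂ (E.basisVecL2 '' c.1),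
        r y ∈ Submodule.span ℂ (E.basisVecL2 '' c.1)) : ∀ y ∈ E.l2Of c.1, r y ∈ E.l2Of c.1 :=
    Set.MapsTo.closure hr r.continuous
  have hp (a : V) := key (π (GraphCStarAlgebra.p E a)) fun y hy => (F.mapsTo_span c hy).1 a
  have hs (e : Ed) := key (π (GraphCStarAlgebra.s E e)) fun y hy => ((F.mapsTo_span c hy).2 e).1
  have ht (e : Ed) := key (π (star (GraphCStarAlgebra.s E e)))
    fun y hy => ((F.mapsTo_span c hy).2 e).2
  refine fun x y hy => (GraphCStarAlgebra.mem_of_gen_mem B hB (fun a y hy => ⟨hp a y hy, ?_⟩)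
    (fun e y hy => ⟨hs e y hy, ht e y hy⟩) x y hy).1
  rw [GraphCStarAlgebra.star_p]
  exact hp a y hy

/-- A boundary path representation contains diagonal operators that separate two given boundary
paths. -/
theorem IsBoundaryStarRep.exists_diagonal (hπ : E.IsBoundaryStarRep π) {α γ : E.Boundary}
    (hαγ : α ≠ γ) : ∃ x, ∃ D : Set E.Boundary, α ∈ D ∧ γ ∉ D ∧
      ∀ y γ, π x y γ = if γ ∈ D then y γ else 0 := by
  obtain ⟨D, ⟨_, ⟨x, rfl⟩, hx⟩, hα, hγ⟩ :=
    ((E.isBoundaryStarRep_iff π).1 hπ).exists_diagonalSet_separating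
      (R := NonUnitalAlgHom.range (toLinearRep π)) (fun a => ⟨GraphCStarAlgebra.p E a, rfl⟩)
      (fun e => ⟨GraphCStarAlgebra.s E e, rfl⟩) (fun e => ⟨star (GraphCStarAlgebra.s E e), rfl⟩)
      hαγ
  exact ⟨x, D, hα, hγ, diagonal_apply_l2 hx⟩

theorem diagonal_apply_basisVecL2 {D : Set E.Boundary}
    {r : E.BoundaryHilbert →L[ℂ] E.BoundaryHilbert}
    (hr : ∀ y γ, r y γ = if γ ∈ D then y γ else 0) {α : E.Boundary} (hα : α ∈ D) :
    r (E.basisVecL2 α) = E.basisVecL2 α :=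
  lp.ext <| funext fun γ => by
    rw [hr]
    obtain rfl | hγ := eq_or_ne γ α
    · rw [if_pos hα]
    · simp [Pi.single_eq_of_ne hγ]

/-- A closed invariant subspace contains a boundary path or is orthogonal to it: its orthogonal
projection commutes with the diagonal operators, so every boundary path is an eigenvector of it. -/
theorem IsBoundaryStarRep.mem_or_mem_orthogonal (hπ : E.IsBoundaryStarRep π)
    {W : Submodule ℂ E.BoundaryHilbert} (hW : IsClosed (W : Set E.BoundaryHilbert))
    (hinv : StarInvariant π W) (α : E.Boundary) : E.basisVecL2 α ∈ W ∨ E.basisVecL2 α ∈ Wᗮ := by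
  have : CompleteSpace W := hW.completeSpace_coe
  have hinv' : StarInvariant π Wᗮ := fun x z hz y hy => by
    rw [← ContinuousLinearMap.adjoint_inner_left, ← ContinuousLinearMap.star_eq_adjoint,
      ← map_star]
    exact hz _ (hinv _ y hy)
  obtain ⟨y, hy, z, hz, hyz⟩ := W.exists_add_mem_mem_orthogonal (E.basisVecL2 α)
  have hyα (γ : E.Boundary) (hγ : γ ≠ α) : y γ = 0 := by
    obtain ⟨x, D, hα, hγD, hx⟩ := hπ.exists_diagonal hγ.symm
    have h : π x y + π x z = y + z := by
      rw [← map_add, ← hyz, diagonal_apply_basisVecL2 hx hα]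
    have hxy : π x y - y ∈ W ⊓ Wᗮ := by
      refine ⟨sub_mem (hinv x y hy) hy, ?_⟩
      rw [sub_eq_sub_iff_add_eq_add.2 (h.trans (add_comm y z))]
      exact sub_mem hz (hinv' x z hz)
    rw [W.inf_orthogonal_eq_bot, Submodule.mem_bot, sub_eq_zero] at hxy
    rw [← hxy, hx, if_neg hγD]
  have hy' : y = y α • E.basisVecL2 α := by
    refine lp.ext (funext fun γ => ?_)
    obtain rfl | hγ := eq_or_ne γ α
    · simp
    · simp [hyα γ hγ, Pi.single_eq_of_ne hγ]
  by_cases h : y α = 0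
  · right
    rw [hyz, hy', h, zero_smul, zero_add]
    exact hz
  · left
    rw [hy'] at hy
    exact (W.smul_mem_iff h).1 hy

theorem IsBoundaryStarRep.starIrreducible (hπ : E.IsBoundaryStarRep π) (c : E.ShiftTailClass)
    (h : StarInvariant π (E.l2Of c.1)) :
    StarIrreducible (starRestrict π (E.l2Of c.1) h) := by
  refine ⟨?_, fun W hW hinv => ?_⟩
  · obtain ⟨α, hα⟩ := c.nonempty
    exact ⟨⟨⟨_, basisVecL2_mem_l2Of hα⟩, 0,
      fun H => basisVecL2_ne_zero α (congrArg Subtype.val H)⟩⟩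
  · let W' : Submodule ℂ E.BoundaryHilbert := W.map (E.l2Of c.1).subtype
    have hW' : IsClosed (W' : Set E.BoundaryHilbert) :=
      (isClosed_l2Of c.1).isClosedEmbedding_subtypeVal.isClosedMap _ hW
    have hinv' : StarInvariant π W' := by
      rintro x _ ⟨z, hz, rfl⟩
      exact ⟨_, hinv x z hz, rfl⟩
    by_cases H : ∃ α ∈ c.1, E.basisVecL2 α ∈ W'
    · right
      obtain ⟨α, hα, hαW⟩ := H
      have hle : E.l2Of c.1 ≤ W' := l2Of_le hW' fun β hβ =>
        ((E.isBoundaryStarRep_iff π).1 hπ).mem_of_shiftTailEquiv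
          (fun e => hinv' _) (fun e => hinv' _)
          (Boundary.cls_eq_iff.1 (((c.mem_iff β).1 hβ).trans ((c.mem_iff α).1 hα).symm)) hαW
      refine Submodule.eq_top_iff'.2 fun z => ?_
      obtain ⟨z', hz', h'⟩ := hle z.2
      rwa [← Subtype.ext (show (z' : E.BoundaryHilbert) = z from h')]
    · left
      have hle : E.l2Of c.1 ≤ W'ᗮ := l2Of_le W'.isClosed_orthogonal fun β hβ =>
        (hπ.mem_or_mem_orthogonal hW' hinv' β).resolve_left fun hβW => H ⟨β, hβ, hβW⟩
      refine W.eq_bot_iff.2 fun z hz => Subtype.ext ?_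
      exact inner_self_eq_zero.1 (hle z.2 z ⟨z, hz, rfl⟩ : ⟪(z : E.BoundaryHilbert), z⟫_ℂ = 0)

/-- An intertwiner sends a path to a vector whose coordinate at every other path vanishes, as the
two paths are separated by a diagonal operator. -/
theorem IsBoundaryStarRep.cls_eq_of_unitarilyEquivalent (hπ : E.IsBoundaryStarRep π)
    {c d : E.ShiftTailClass} {hc : StarInvariant π (E.l2Of c.1)}
    {hd : StarInvariant π (E.l2Of d.1)}
    (h : UnitarilyEquivalent (starRestrict π (E.l2Of c.1) hc) (starRestrict π (E.l2Of d.1) hd)) :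
    c = d := by
  by_contra hcd
  obtain ⟨U, hU⟩ := h
  obtain ⟨α, hα⟩ := c.nonempty
  let y : E.l2Of c.1 := ⟨E.basisVecL2 α, basisVecL2_mem_l2Of hα⟩
  have hy : y ≠ 0 := fun H => basisVecL2_ne_zero α (congrArg Subtype.val H)
  refine hy (U.map_eq_zero_iff.1 (Subtype.ext (lp.ext (funext fun γ => ?_))))
  by_cases hγ : γ ∈ d.1
  · have hαγ : α ≠ γ := fun H =>
      Set.disjoint_left.1 (ShiftTailClass.pairwise_disjoint hcd) hα (H ▸ hγ)
    obtain ⟨x, D, hαD, hD, hx⟩ := hπ.exists_diagonal hαγ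
    have hxy : starRestrict π _ hc x y = y := Subtype.ext (diagonal_apply_basisVecL2 hx hαD)
    have hxU : U (starRestrict π _ hc x y) = starRestrict π _ hd x (U y) := by
      rw [hU, LinearIsometryEquiv.apply_symm_apply]
    rw [← hxy, hxU]
    exact (hx (U y) γ).trans (if_neg hD)
  · exact apply_eq_zero_of_mem_l2Of (U y).2 hγ

theorem IsBoundaryStarRep.tfae (hπ : E.IsBoundaryStarRep π)
    (hinv : ∀ c : E.ShiftTailClass, StarInvariant π (E.l2Of c.1)) (α β : E.Boundary) :
    List.TFAE [
      UnitarilyEquivalent (starRestrict π (E.l2Of α.cls.1) (hinv α.cls))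
        (starRestrict π (E.l2Of β.cls.1) (hinv β.cls)),
      (⟨E.l2Of α.cls.1, starRestrict π _ (hinv α.cls)⟩ :
          StarRepOn E.GraphCStarAlgebra E.BoundaryHilbert) =
        ⟨E.l2Of β.cls.1, starRestrict π _ (hinv β.cls)⟩,
      α.ShiftTailEquiv β,
      α.cls = β.cls] := by
  tfae_have 1 → 4 := hπ.cls_eq_of_unitarilyEquivalent
  tfae_have 4 → 2 := fun h => by rw [h]
  tfae_have 2 → 1 := UnitarilyEquivalent.of_eq
  tfae_have 3 ↔ 4 := Boundary.cls_eq_iff.symm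
  tfae_finish

end StarRep

end DirGraph

end

theorem mainTheorem2 {V : Type u} {Ed : Type v} (E : DirGraph V Ed) :
    (∀ (k : Type w) [Field k],
      (∃! ρ : E.LeavittPathAlgebra k →ₙₐ[k] Module.End k (E.BoundarySpace k),
        E.IsBoundaryRep k ρ) ∧
      ∀ ρ : E.LeavittPathAlgebra k →ₙₐ[k] Module.End k (E.BoundarySpace k),
        E.IsBoundaryRep k ρ →
        ∃ hinv : ∀ c : E.ShiftTailClass, AlgInvariant ρ (E.spanOf k c.1),
          (∀ c : E.ShiftTailClass, AlgIrreducible (algRestrict ρ (E.spanOf k c.1) (hinv c))) ∧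
          IsAlgDirectSum ρ (fun c : E.ShiftTailClass => E.spanOf k c.1)
            (fun c => algRestrict ρ (E.spanOf k c.1) (hinv c)) ∧
          ∀ α β : E.Boundary, List.TFAE [
            AlgEquivalent (algRestrict ρ (E.spanOf k α.cls.1) (hinv α.cls))
              (algRestrict ρ (E.spanOf k β.cls.1) (hinv β.cls)),
            (⟨E.spanOf k α.cls.1, algRestrict ρ _ (hinv α.cls)⟩ :
                AlgRepOn k (E.LeavittPathAlgebra k) (E.BoundarySpace k)) =
              ⟨E.spanOf k β.cls.1, algRestrict ρ _ (hinv β.cls)⟩,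
            α.ShiftTailEquiv β,
            α.cls = β.cls]) ∧
    ((∃! π : E.GraphCStarAlgebra →⋆ₙₐ[ℂ] (E.BoundaryHilbert →L[ℂ] E.BoundaryHilbert),
        E.IsBoundaryStarRep π) ∧
      ∀ π : E.GraphCStarAlgebra →⋆ₙₐ[ℂ] (E.BoundaryHilbert →L[ℂ] E.BoundaryHilbert),
        E.IsBoundaryStarRep π →
        ∃ hinv : ∀ c : E.ShiftTailClass, StarInvariant π (E.l2Of c.1),
          (∀ c : E.ShiftTailClass, StarIrreducible (starRestrict π (E.l2Of c.1) (hinv c))) ∧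
          IsStarDirectSum π (fun c : E.ShiftTailClass => E.l2Of c.1)
            (fun c => starRestrict π (E.l2Of c.1) (hinv c)) ∧
          ∀ α β : E.Boundary, List.TFAE [
            UnitarilyEquivalent (starRestrict π (E.l2Of α.cls.1) (hinv α.cls))
              (starRestrict π (E.l2Of β.cls.1) (hinv β.cls)),
            (⟨E.l2Of α.cls.1, starRestrict π _ (hinv α.cls)⟩ :
                StarRepOn E.GraphCStarAlgebra E.BoundaryHilbert) =
              ⟨E.l2Of β.cls.1, starRestrict π _ (hinv β.cls)⟩,
            α.ShiftTailEquiv β,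
            α.cls = β.cls]) := by
  refine ⟨fun k _ => ⟨E.existsUnique_isBoundaryRep k, fun ρ hρ => ⟨hρ.algInvariant,
      fun c => hρ.algIrreducible c _, .of_isInternal DirGraph.isInternal_spanOf _, hρ.tfae _⟩⟩,
    E.existsUnique_isBoundaryStarRep, fun π hπ => ⟨hπ.starInvariant,
      fun c => hπ.starIrreducible c _, .of_isHilbertSum DirGraph.isHilbertSum_l2Of _, hπ.tfae _⟩⟩
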